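/- **Setting.** There are $k\ge 1$ arms with reward distributions on $\{0,1\}$; $\mu_a$ is the mean of arm $a$, $\mu^*=\max_a\mu_a$, and $\Delta_a=\mu^*-\mu_a$. A shuffle-model bandit algorithm serves $T$ users in consecutive batches. For each batch it chooses, from the outputs on the earlier batches, a size $m$, an arm $a$ that all $m$ users pull (obtaining independent rewards), and an $m$-user shuffle mechanism that is applied to the $m$ rewards; the run stops when $T$ users have pulled (possibly inside a batch). If $N_a$ is the number of pulls of arm $a$, the regret is $R(T)=\mathbb E\big[\sum_a N_a\Delta_a\big]$. An $m$-user shuffle mechanism on bits consists of a (discretely distributed) local randomizer $E$ mapping a bit to a finite sequence of messages, applied independently by each user, a shuffler that permutes all messages uniformly at random, and an analyzer that computes a real number from the shuffled messages. It is $(\varepsilon,\delta)$-SDP if for all inputs $x,x'\in\{0,1\}^m$ differing in at most one entry and every set $B$ of message sequences, the shuffler's output satisfies $P_x(B)\le e^{\varepsilon}P_{x'}(B)+\delta$. A bandit algorithm is $(\varepsilon,\delta)$-SDP if every mechanism that it applies to a batch is. An $m$-user mechanism is an *$(\varepsilon,\delta)$-private binary summation mechanism with error parameter $\sigma\ge0$*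 if it is $(\varepsilon,\delta)$-SDP and its output on $x$ is distributed as $\sum_i x_i+e$, where the law of $e$ does not depend on $x$, $\mathbb E[e]=0$ and $\mathbb E[\exp(\lambda e)]\le \exp(\lambda^2\sigma^2/2)$ for all $\lambda\in\mathbb R$. **The algorithm SDP-AE** with batch size $m$, such a mechanism $M$, parameter $\sigma$ and horizon $T$: all arms are viable initially. In phase $t=1,2,\dots$, for each viable arm $a$ in turn, a batch of $m$ new users pulls $a$, $M$ is applied to their rewards and its output is added to $\hat S_a$, and $m$ is added to $N_a$. After the phase put $\hat\mu_a=\hat S_a/N_a$ and $I_a=\Big(\frac{2\sqrt t\,\sigma}{N_a}+\frac1{\sqrt{N_a}}\Big)\sqrt{2\log T}$, and remove every viable arm $a$ with $\hat\mu_a+I_a<\max_{b\text{ viable}}(\hat\mu_b-I_b)$. **Claim.** (1) For all $c_1,c_2,c_3>0$ there is a constant $C>0$ such that the following holds for all $\varepsilon,\delta\in(0,1)$. Let $c_1\frac{\log(1/\delta)}{\varepsilon^2}\le m\le c_2\frac{\log(1/\delta)}{\varepsilon^2}$, let $\sigma^2\le c_3\frac{\log(1/\delta)}{\varepsilon^2}$,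 and let $M$ be an $m$-user $(\varepsilon,\delta)$-private binary summation mechanism with error parameter $\sigma$. Then for all $k$ and $T$, SDP-AE is $(\varepsilon,\delta)$-SDP, and for all reward distributions $$R(T)\le C\sum_{a:\Delta_a>0}\Big(\frac{\log T}{\Delta_a}+\frac{\Delta_a\log(1/\delta)}{\varepsilon^2}\Big),\qquad R(T)\le C\Big(\sum_{a:\Delta_a>0}\frac{\log T}{\Delta_a}+\frac{k\log(1/\delta)}{\varepsilon^2}\Big),$$ $$R(T)\le C\Big(\sqrt{kT\log T}+\frac{k\log(1/\delta)}{\varepsilon^2}\Big).$$ (2) Such mechanisms exist explicitly. Let $\tau=96\log(2/\delta)/\varepsilon^2$ and let $M_{\mathrm{sum}}$ be the $m$-user mechanism in which a user with bit $x$ sends $x$ and $\lceil\tau/m\rceil$ independent fair bits if $m\le\tau$, and $x$ and one Bernoulli$(\tau/(2m))$ bit if $m>\tau$, and the analyzer outputs the number of ones received minus $\lceil\tau/m\rceil m/2$ if $m\le\tau$, and minus $\tau/2$ if $m>\tau$. For all $\delta_0\in(0,1)$ and $c_0>0$ there are $c_1,c_2>0$ such that for all $\varepsilon\in(0,1)$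 and $\delta\in(0,\delta_0]$ there is $\sigma\ge 0$ with $c_1\frac{\log(1/\delta)}{\varepsilon^2}\le\lceil\sigma^2\rceil\le c_2\frac{\log(1/\delta)}{\varepsilon^2}$ such that $M_{\mathrm{sum}}$ is an $(\varepsilon,\delta)$-private binary summation mechanism with error parameter $\sigma$ for $m=\lceil\sigma^2\rceil$ and for every $m\ge1$ with $m\le c_0\frac{\log(1/\delta)}{\varepsilon^2}$. Hence (1) applies to $M_{\mathrm{sum}}$ with these batch sizes. -/

import Mathlib

open MeasureTheory ProbabilityTheory
open scoped NNReal ENNReal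

/-! ### Discrete randomness -/

/-- Joint law of independent random variables `Z 0, …, Z (n - 1)`, where `Z i` has law `p i`. -/
noncomputable def indep {α : Type*} : {n : ℕ} → (Fin n → PMF α) → PMF (Fin n → α)
  | 0, _ => PMF.pure Fin.elim0
  | _ + 1, p => (p 0).bind fun a => (indep fun i => p i.succ).map fun f => Fin.cons a f

/-- The Bernoulli law with success probability `p` (clamped to `[0, 1]`). -/
noncomputable def coin (p : ℝ) : PMF Bool :=
  PMF.ofFintype
    (fun b => ENNReal.ofReal (if b then max 0 (min p 1) else 1 - max 0 (min p 1))) (by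
      have h0 : (0 : ℝ) ≤ max 0 (min p 1) := le_max_left _ _
      have h1 : max 0 (min p 1) ≤ (1 : ℝ) := max_le zero_le_one (min_le_right _ _)
      rw [Fintype.sum_bool]
      simp only [if_true, Bool.false_eq_true, if_false]
      rw [← ENNReal.ofReal_add h0 (sub_nonneg.2 h1)]
      simp)

/-- A uniformly random permutation of a list of messages: the output of the shuffler. -/
noncomputable def shuffle {Y : Type*} (l : List Y) : PMF (List Y) :=
  (PMF.uniformOfFintype (Equiv.Perm (Fin l.length))).map fun s => List.ofFn fun i => l.get (s i)

/-! ### Shuffle mechanisms on bits -/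

/-- A single-round shuffle-model mechanism for `m` users holding one bit each: a local randomizer
sending a finite sequence of messages, and an analyzer that sees only the shuffled messages. -/
structure ShuffleMechanism (m : ℕ) (Y : Type*) where
  encode : Bool → PMF (List Y)
  analyze : List Y → ℝ

namespace ShuffleMechanism

variable {m : ℕ} {Y : Type*}

/-- Law of the shuffler's output when the users hold the bits `x`. -/
noncomputable def shuffled (M : ShuffleMechanism m Y) (x : Fin m → Bool) : PMF (List Y) :=
  (indep fun i => M.encode (x i)).bind fun msgs => shuffle (List.ofFn msgs).flatten

/-- Law of the analyzer's output when the users hold the bits `x`. -/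
noncomputable def output (M : ShuffleMechanism m Y) (x : Fin m → Bool) : PMF ℝ :=
  (M.shuffled x).map M.analyze

/-- `(ε, δ)`-shuffle differential privacy: the shuffler's output is `(ε, δ)`-differentially private
with respect to changing the bit of one user. -/
def IsSDP (M : ShuffleMechanism m Y) (ε δ : ℝ) : Prop :=
  ∀ x x' : Fin m → Bool, hammingDist x x' ≤ 1 → ∀ B : Set (List Y),
    (M.shuffled x).toOuterMeasure B
      ≤ ENNReal.ofReal (Real.exp ε) * (M.shuffled x').toOuterMeasure B + ENNReal.ofReal δ

/-- `M` estimates the sum of the users' bits, with an additive error whose law does not depend on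
the input, has mean zero and is sub-Gaussian with variance `σ ^ 2`. -/
def HasSubgaussianError (M : ShuffleMechanism m Y) (σ : ℝ≥0) : Prop :=
  ∃ err : PMF ℝ,
    (∀ x : Fin m → Bool, M.output x = err.map fun e => (∑ i, if x i then (1 : ℝ) else 0) + e) ∧
    ∫ e, e ∂err.toMeasure = 0 ∧
    HasSubgaussianMGF id (σ ^ 2) err.toMeasure

/-- An `(ε, δ)`-private binary summation mechanism with error of sub-Gaussian variance `σ ^ 2`. -/
def IsPrivateBinarySum (M : ShuffleMechanism m Y) (ε δ : ℝ) (σ : ℝ≥0) : Prop :=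
  M.IsSDP ε δ ∧ M.HasSubgaussianError σ

end ShuffleMechanism

/-- The parameter `τ = 96 log (2 / δ) / ε ^ 2`. -/
noncomputable def noiseParam (ε δ : ℝ) : ℝ := 96 * Real.log (2 / δ) / ε ^ 2

open Classical in
/-- The explicit binary summation mechanism: every user sends its bit together with noise bits
(`⌈τ / m⌉` fair bits if `m ≤ τ`, and one bit with bias `τ / (2 m)` otherwise), and the analyzer
counts the ones and subtracts the expected number of noise ones. -/
noncomputable def binarySum (ε δ : ℝ) (m : ℕ) : ShuffleMechanism m Bool where
  encode x :=
    if (m : ℝ) ≤ noiseParam ε δ then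
      (indep fun _ : Fin ⌈noiseParam ε δ / m⌉₊ => coin (1 / 2)).map fun y => x :: List.ofFn y
    else
      (coin (noiseParam ε δ / (2 * m))).map fun y => [x, y]
  analyze z :=
    (z.count true : ℝ) -
      if (m : ℝ) ≤ noiseParam ε δ then (⌈noiseParam ε δ / m⌉₊ : ℝ) * m / 2
      else noiseParam ε δ / 2

/-! ### Shuffle-model multi-armed bandits with `k` arms and binary rewards -/

/-- A batch: its number of (fresh) users, the arm that all of them pull, and the mechanism that is
applied to their rewards. -/
structure Batch (k : ℕ) (Y : Type*) where
  size : ℕ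
  arm : Fin k
  mech : ShuffleMechanism size Y

/-- A bandit algorithm in the shuffle model: it chooses the next batch from the outputs of the
mechanisms on the previous batches (in chronological order). -/
def Policy (k : ℕ) (Y : Type*) : Type _ := List ℝ → Batch k Y

namespace Policy

variable {k : ℕ} {Y : Type*}

/-- An algorithm is `(ε, δ)`-SDP if the mechanism that it applies to any batch is. -/
def IsSDP (π : Policy k Y) (ε δ : ℝ) : Prop := ∀ h : List ℝ, (π h).mech.IsSDP ε δ

/-- Law of the number of pulls of each arm at the end of the run. The arguments are the number of
rounds still allowed, the number `n` of users left, the outputs so far and the numbers of pulls so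
far. The rewards of the users of a batch are independent draws from the reward law of its arm. The
run stops as soon as no user is left, within a batch if necessary. -/
noncomputable def runFrom (π : Policy k Y) (ν : Fin k → PMF Bool) :
    ℕ → ℕ → List ℝ → (Fin k → ℕ) → PMF (Fin k → ℕ)
  | 0, _, _, N => PMF.pure N
  | r + 1, n, h, N =>
    if n ≤ (π h).size then PMF.pure (N + Pi.single (π h).arm n)
    else
      ((indep fun _ : Fin (π h).size => ν (π h).arm).bind (π h).mech.output).bind fun z =>
        π.runFrom ν r (n - (π h).size) (h ++ [z]) (N + Pi.single (π h).arm (π h).size)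

/-- Law of the numbers of pulls `(N_a)` of the arms when there are `T` users in total. (If no batch
is empty, there are at most `T` rounds.) -/
noncomputable def pulls (π : Policy k Y) (ν : Fin k → PMF Bool) (T : ℕ) : PMF (Fin k → ℕ) :=
  π.runFrom ν T T [] 0

end Policy

/-- The expected reward `μ_a` of arm `a`. -/
noncomputable def meanReward {k : ℕ} (ν : Fin k → PMF Bool) (a : Fin k) : ℝ := (ν a true).toReal

/-- The gap `Δ_a = μ^* - μ_a` of arm `a`. -/
noncomputable def gap {k : ℕ} (ν : Fin k → PMF Bool) (a : Fin k) : ℝ :=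
  (⨆ b, meanReward ν b) - meanReward ν a

/-- The pseudo-regret `E[∑_a N_a Δ_a]` for `T` users. -/
noncomputable def regret {k : ℕ} {Y : Type*} (π : Policy k Y) (ν : Fin k → PMF Bool) (T : ℕ) : ℝ :=
  ∫ N : Fin k → ℕ, ∑ a, (N a : ℝ) * gap ν a ∂(π.pulls ν T).toMeasure

/-! ### Shuffle differentially private arm elimination -/

/-- State of the algorithm between two batches. -/
structure AEState (k : ℕ) where
  /-- the set `V` of viable arms -/
  viable : Finset (Fin k)
  /-- the current phase `t` -/
  phase : ℕ
  /-- the viable arms that have not yet been served in the current phase -/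
  queue : List (Fin k)
  /-- the noisy cumulative sums of rewards -/
  S : Fin k → ℝ
  /-- the numbers of pulls -/
  N : Fin k → ℕ

namespace AEState

variable {k : ℕ}

def init (k : ℕ) : AEState k where
  viable := Finset.univ
  phase := 1
  queue := List.finRange k
  S := 0
  N := 0

/-- The half-width `(2 √t σ / N_a + 1 / √N_a) √(2 log T)` of the confidence interval of arm `a`. -/
noncomputable def width (s : AEState k) (σ : ℝ) (T : ℕ) (a : Fin k) : ℝ :=
  (2 * √(s.phase : ℝ) * σ / s.N a + 1 / √(s.N a : ℝ)) * √(2 * Real.log T)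

noncomputable def ucb (s : AEState k) (σ : ℝ) (T : ℕ) (a : Fin k) : ℝ :=
  s.S a / s.N a + s.width σ T a

noncomputable def lcb (s : AEState k) (σ : ℝ) (T : ℕ) (a : Fin k) : ℝ :=
  s.S a / s.N a - s.width σ T a

open Classical in
/-- End of a phase: remove the viable arms whose upper confidence bound is below the lower
confidence bound of some viable arm, and start the next phase with the remaining arms. -/
noncomputable def endPhase (s : AEState k) (σ : ℝ) (T : ℕ) : AEState k :=
  let V := s.viable.filter fun a => ¬ ∃ b ∈ s.viable, s.ucb σ T a < s.lcb σ T b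
  { s with viable := V, phase := s.phase + 1, queue := (List.finRange k).filter fun a => a ∈ V }

/-- Server update after the batch of `m` users of the first arm of the queue, when the mechanism
has returned `z`. -/
noncomputable def update (m : ℕ) (σ : ℝ) (T : ℕ) (s : AEState k) (z : ℝ) : AEState k :=
  match s.queue with
  | [] => s
  | a :: rest =>
    let s' : AEState k :=
      { s with queue := rest, S := s.S + Pi.single a z, N := s.N + Pi.single a m }
    if rest.isEmpty then s'.endPhase σ T else s'

end AEState

/-- Arm elimination with batches of `m` users, mechanism `M`, error parameter `σ` and horizon `T`.
The queue is never empty, so the default arm is never used. -/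
noncomputable def sdpAE (k : ℕ) [NeZero k] {m : ℕ} {Y : Type*} (M : ShuffleMechanism m Y)
    (σ : ℝ) (T : ℕ) : Policy k Y := fun h =>
  { size := m
    arm := (h.foldl (AEState.update m σ T) (AEState.init k)).queue.headD 0
    mech := M }

/-! Privacy in (1) is immediate: every batch consists of fresh users and is processed by `M`. Write
L = log(1/δ)/ε². The regret bounds all come from one estimate of expected pulls: a suboptimal arm is
pulled at most m + 2 + O((1 + σ²/m) log T / Δ²) times, where m = Θ(L) and σ²/m = O(1).

That estimate combines a deterministic and a probabilistic part. Deterministically, as long as every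
noisy sum lies in its confidence interval when a batch ends, optimal arms survive, and an arm
surviving a phase has gap at most four half-widths; this bounds the number of its phases
(`AEState.Invariant`, `phase_mul_le_of_gap_le`). Probabilistically, the noisy sum of a batch is
sub-Gaussian with variance proxy m/4 + σ² (`expect_exp_batch_le`). Since batches are chosen
adaptively, no sample space of all rewards is built. Instead `aePotential`, a sum over arms and
future phases of two-sided Chernoff bounds, is a supermartingale along the run, and the term of the
phase just completed pays for the event that its interval fails. Induction over rounds gives E[N_a]
≤ (good-event bound) + T · (potential) (`expect_sdpAE_runFrom_le`). The initial potential is at most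
2kT·T⁻⁴, so the failure cost is at most 2 when k ≤ T; for T ≤ k the first phase is never exceeded
and m pulls suffice. The gap-free bound splits the arms at gap √(k log T / T).

For (2), both regimes are instances of `noisyBitSum`: n = mq noise bits of bias p ≤ 1/2 with np ≥
τ/2. Shuffled bits reveal only their number of ones, so privacy says that Bin(n, p) and its shift by
one are (ε, δ)-close. Consecutive binomial probabilities have ratio (n − c)p / ((c + 1)(1 − p)),
which is within the factor e^ε unless c leaves np(1 ± 0.3ε), and a Chernoff bound gives these tails
mass at most δ. Hoeffding's lemma gives variance proxy n/4 for the error, so σ² = τ + c₀L suffices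
for all the batch sizes. -/

/-! ### Expectations under discrete laws -/

/-- Expectation of a nonnegative function under a discrete law. -/
noncomputable def PMF.expect {α : Type*} (p : PMF α) (f : α → ℝ≥0∞) : ℝ≥0∞ := ∑' x, p x * f x

namespace PMF

variable {α β : Type*}

theorem expect_pure (a : α) (f : α → ℝ≥0∞) : (PMF.pure a).expect f = f a := by
  classical
  unfold expect
  rw [tsum_eq_single a]
  · simp
  · intro b hb; simp [hb]

theorem expect_bind (p : PMF α) (g : α → PMF β) (f : β → ℝ≥0∞) :
    (p.bind g).expect f = p.expect fun a => (g a).expect f := by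
  unfold expect
  simp only [PMF.bind_apply, ← ENNReal.tsum_mul_right, ← ENNReal.tsum_mul_left]
  rw [ENNReal.tsum_comm]
  simp only [mul_assoc]

theorem expect_map (p : PMF α) (g : α → β) (f : β → ℝ≥0∞) :
    (p.map g).expect f = p.expect fun a => f (g a) := by
  rw [← PMF.bind_pure_comp, expect_bind]
  simp [expect_pure]

theorem expect_mono (p : PMF α) {f g : α → ℝ≥0∞} (h : ∀ x, f x ≤ g x) :
    p.expect f ≤ p.expect g :=
  ENNReal.tsum_le_tsum fun x => mul_le_mul_right (h x) _

theorem expect_const (p : PMF α) (c : ℝ≥0∞) : p.expect (fun _ => c) = c := by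
  unfold expect
  rw [ENNReal.tsum_mul_right, p.tsum_coe, one_mul]

theorem expect_add (p : PMF α) (f g : α → ℝ≥0∞) :
    p.expect (fun x => f x + g x) = p.expect f + p.expect g := by
  unfold expect
  simp only [mul_add]
  exact ENNReal.tsum_add

theorem expect_const_mul (p : PMF α) (c : ℝ≥0∞) (f : α → ℝ≥0∞) :
    p.expect (fun x => c * f x) = c * p.expect f := by
  unfold expect
  rw [← ENNReal.tsum_mul_left]
  simp only [mul_left_comm]

theorem expect_mul_const (p : PMF α) (c : ℝ≥0∞) (f : α → ℝ≥0∞) :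
    p.expect (fun x => f x * c) = p.expect f * c := by
  simp only [mul_comm _ c, expect_const_mul]

theorem expect_finset_sum {ι : Type*} (p : PMF α) (s : Finset ι) (f : ι → α → ℝ≥0∞) :
    p.expect (fun x => ∑ i ∈ s, f i x) = ∑ i ∈ s, p.expect (f i) := by
  classical
  induction s using Finset.induction_on with
  | empty => simp [expect]
  | insert i s hi ih => simp only [Finset.sum_insert hi, expect_add, ih]

/-- Links the series `PMF.expect` to Lebesgue integrals without countability of the space, as is
needed for discrete laws on ℝ. -/
theorem toMeasure_eq_sum_dirac [MeasurableSpace α] (p : PMF α) :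
    p.toMeasure = Measure.sum fun x => p x • Measure.dirac x := by
  ext s hs
  rw [PMF.toMeasure_apply _ hs, Measure.sum_apply _ hs]
  refine tsum_congr fun x => ?_
  by_cases h : x ∈ s <;> simp [Measure.dirac_apply' _ hs, h]

theorem lintegral_toMeasure [MeasurableSpace α] (p : PMF α) {f : α → ℝ≥0∞} (hf : Measurable f) :
    ∫⁻ x, f x ∂p.toMeasure = p.expect f := by
  rw [toMeasure_eq_sum_dirac, lintegral_sum_measure]
  refine tsum_congr fun x => ?_
  rw [lintegral_smul_measure, lintegral_dirac' _ hf, smul_eq_mul]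

theorem toOuterMeasure_eq_expect (p : PMF α) (B : Set α) :
    p.toOuterMeasure B = p.expect (B.indicator 1) := by
  rw [PMF.toOuterMeasure_apply]
  refine tsum_congr fun x => ?_
  by_cases h : x ∈ B <;> simp [h]

theorem toOuterMeasure_bind_eq_expect (p : PMF α) (g : α → PMF β) (B : Set β) :
    (p.bind g).toOuterMeasure B = p.expect fun a => (g a).toOuterMeasure B := by
  simp only [toOuterMeasure_eq_expect, expect_bind]

/-- The expectation of a product of functions of independent variables. -/
theorem expect_indep_prod : ∀ {n : ℕ} (p : Fin n → PMF α) (f : Fin n → α → ℝ≥0∞),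
    (indep p).expect (fun x => ∏ i, f i (x i)) = ∏ i, (p i).expect (f i)
  | 0, p, f => by simp [indep, expect_pure]
  | n + 1, p, f => by
    simp only [indep, expect_bind, expect_map, Fin.prod_univ_succ, Fin.cons_zero, Fin.cons_succ,
      expect_const_mul, expect_mul_const]
    rw [expect_indep_prod (fun i => p i.succ) (fun i => f i.succ)]

end PMF

/-! ### Moment generating functions -/

/-- Hoeffding's lemma for one bit. -/
theorem expect_exp_bit_le (p : PMF Bool) (t : ℝ) :
    p.expect (fun b => ENNReal.ofReal (Real.exp (t * ((if b then 1 else 0) - (p true).toReal))))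
      ≤ ENNReal.ofReal (Real.exp (t ^ 2 / 8)) := by
  have hm : ∀ f : Bool → ℝ, AEMeasurable f p.toMeasure := fun f =>
    (measurable_of_finite f).aemeasurable
  have h := hasSubgaussianMGF_of_mem_Icc (μ := p.toMeasure) (a := 0) (b := 1)
    (X := fun b : Bool => if b then (1 : ℝ) else 0) (hm _)
    (Filter.Eventually.of_forall fun b => by cases b <;> simp)
  have hmean : ∫ b, (if b then (1 : ℝ) else 0) ∂p.toMeasure = (p true).toReal := by
    rw [PMF.integral_eq_sum]; simp
  rw [hmean] at h
  have h1 := h.mgf_le t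
  have h2 := ofReal_integral_eq_lintegral_ofReal (h.integrable_exp_mul t)
    (Filter.Eventually.of_forall fun _ => (Real.exp_pos _).le)
  rw [PMF.lintegral_toMeasure _ (measurable_of_finite _)] at h2
  rw [← h2]
  refine ENNReal.ofReal_le_ofReal (h1.trans (le_of_eq ?_))
  congr 1
  norm_num
  ring

theorem expect_exp_of_hasSubgaussianMGF (p : PMF ℝ) (c : ℝ≥0)
    (h : HasSubgaussianMGF id c p.toMeasure) (t : ℝ) :
    p.expect (fun e => ENNReal.ofReal (Real.exp (t * e)))
      ≤ ENNReal.ofReal (Real.exp (c * t ^ 2 / 2)) := by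
  have h2 := ofReal_integral_eq_lintegral_ofReal (h.integrable_exp_mul t)
    (Filter.Eventually.of_forall fun _ => (Real.exp_pos _).le)
  rw [PMF.lintegral_toMeasure _ (by fun_prop)] at h2
  simp only [id] at h2
  rw [← h2]
  exact ENNReal.ofReal_le_ofReal (h.mgf_le t)

theorem hasSubgaussianMGF_of_expect_exp (p : PMF ℝ) (c : ℝ≥0)
    (h : ∀ t : ℝ, p.expect (fun e => ENNReal.ofReal (Real.exp (t * e)))
      ≤ ENNReal.ofReal (Real.exp (c * t ^ 2 / 2))) :
    HasSubgaussianMGF id c p.toMeasure := by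
  have hl : ∀ t : ℝ, ∫⁻ e, ENNReal.ofReal (Real.exp (t * e)) ∂p.toMeasure
      ≤ ENNReal.ofReal (Real.exp (c * t ^ 2 / 2)) := fun t => by
    rw [PMF.lintegral_toMeasure _ (by fun_prop)]; exact h t
  have hi : ∀ t : ℝ, Integrable (fun e : ℝ => Real.exp (t * e)) p.toMeasure := fun t => by
    refine ⟨by fun_prop, ?_⟩
    rw [hasFiniteIntegral_iff_ofReal (Filter.Eventually.of_forall fun _ => (Real.exp_pos _).le)]
    exact (hl t).trans_lt ENNReal.ofReal_lt_top
  refine ⟨hi, fun t => ?_⟩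
  have h2 := ofReal_integral_eq_lintegral_ofReal (hi t)
    (Filter.Eventually.of_forall fun _ => (Real.exp_pos _).le)
  refine (ENNReal.ofReal_le_ofReal_iff (Real.exp_pos _).le).1 ?_
  exact h2.le.trans (hl t)

/-- The noisy sum of a batch of `m` rewards with mean `μ` is sub-Gaussian around `m μ`. -/
theorem expect_exp_batch_le {m : ℕ} {Y : Type*} (M : ShuffleMechanism m Y) (σ : ℝ≥0)
    (hM : M.HasSubgaussianError σ) (p : PMF Bool) (t : ℝ) :
    ((indep fun _ : Fin m => p).bind M.output).expect
        (fun z => ENNReal.ofReal (Real.exp (t * (z - m * (p true).toReal))))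
      ≤ ENNReal.ofReal (Real.exp ((m / 4 + σ ^ 2) * t ^ 2 / 2)) := by
  obtain ⟨err, hout, -, hsub⟩ := hM
  -- The error has the same law for every reward vector, so conditionally on the rewards its factor
  -- comes out as a constant.
  have key : ∀ x : Fin m → Bool, (M.output x).expect
      (fun z => ENNReal.ofReal (Real.exp (t * (z - m * (p true).toReal))))
      ≤ (∏ i, ENNReal.ofReal (Real.exp (t * ((if x i then 1 else 0) - (p true).toReal)))) *
        ENNReal.ofReal (Real.exp (σ ^ 2 * t ^ 2 / 2)) := fun x => by
    rw [hout, PMF.expect_map]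
    have h := expect_exp_of_hasSubgaussianMGF err _ hsub t
    push_cast at h
    refine le_trans (le_of_eq ?_) (mul_le_mul_right h _)
    rw [← PMF.expect_const_mul]
    congr 1
    funext e
    rw [← ENNReal.ofReal_prod_of_nonneg (fun _ _ => (Real.exp_pos _).le), ← Real.exp_sum,
      ← ENNReal.ofReal_mul (Real.exp_pos _).le, ← Real.exp_add]
    congr 2
    simp [← Finset.mul_sum]
    ring
  rw [PMF.expect_bind]
  refine (PMF.expect_mono _ key).trans ?_
  rw [PMF.expect_mul_const, PMF.expect_indep_prod (fun _ : Fin m => p)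
    (fun _ b => ENNReal.ofReal (Real.exp (t * ((if b then 1 else 0) - (p true).toReal))))]
  refine (mul_le_mul_left (Finset.prod_le_prod' fun i _ => expect_exp_bit_le p t) _).trans ?_
  rw [← ENNReal.ofReal_prod_of_nonneg (fun _ _ => (Real.exp_pos _).le), ← Real.exp_sum,
      ← ENNReal.ofReal_mul (Real.exp_pos _).le, ← Real.exp_add]
  refine le_of_eq ?_
  congr 2
  simp
  ring

/-! ### Exponential potential for a batched random walk -/

/-- `N` times the half-width of the confidence interval in phase `t`. -/
noncomputable def aeThreshold (m : ℕ) (σ : ℝ) (T t : ℕ) : ℝ :=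
  (2 * √(t : ℝ) * σ + √((t : ℝ) * m)) * √(2 * Real.log T)

/-- Variance proxy of the noisy sum of one batch, divided by the size of the batch. -/
noncomputable def aeVariance (m : ℕ) (σ : ℝ) : ℝ := 1 / 4 + σ ^ 2 / m

/-- Optimal exponent of the Chernoff bound at the end of phase `t`. -/
noncomputable def aeExponent (m : ℕ) (σ : ℝ) (T t : ℕ) : ℝ :=
  aeThreshold m σ T t / (t * m * aeVariance m σ)

/-- Exponential upper bound for the probability that a sum deviating by `y` after `n` pulls will
deviate by more than `l * thr` after `tm` pulls. -/
noncomputable def oneSidedPotential (l thr w tm y n : ℝ) : ℝ≥0∞ :=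
  ENNReal.ofReal (Real.exp (l * y - |l| * thr + (tm - n) * w * l ^ 2 / 2))

noncomputable def deviationPotential (m : ℕ) (σ : ℝ) (T : ℕ) (t : ℕ) (y n : ℝ) : ℝ≥0∞ :=
  oneSidedPotential (aeExponent m σ T t) (aeThreshold m σ T t) (aeVariance m σ) (t * m) y n +
  oneSidedPotential (-aeExponent m σ T t) (aeThreshold m σ T t) (aeVariance m σ) (t * m) y n

/-- Upper bound for the probability that the noisy sum `x` of `n` rewards with mean `μ` will leave
its confidence interval at the end of a later phase. -/
noncomputable def armPotential (m : ℕ) (σ : ℝ) (T : ℕ) (μ x : ℝ) (n : ℕ) : ℝ≥0∞ :=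
  ∑ t ∈ Finset.Icc 1 T with n < t * m, deviationPotential m σ T t (x - n * μ) n

theorem aeThreshold_nonneg (m : ℕ) (σ : ℝ≥0) (T t : ℕ) : 0 ≤ aeThreshold m σ T t := by
  unfold aeThreshold; positivity

theorem aeVariance_pos (m : ℕ) (σ : ℝ) : 0 < aeVariance m σ := by
  unfold aeVariance; positivity

theorem aeExponent_nonneg (m : ℕ) (σ : ℝ≥0) (T t : ℕ) : 0 ≤ aeExponent m σ T t :=
  div_nonneg (aeThreshold_nonneg m σ T t) (mul_nonneg (by positivity) (aeVariance_pos m σ).le)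

/-- One batch does not increase the potential on average. -/
theorem expect_oneSidedPotential_le {m : ℕ} (hm : 0 < m) {Y : Type*} (M : ShuffleMechanism m Y)
    (σ : ℝ≥0) (hM : M.HasSubgaussianError σ) (p : PMF Bool) (l thr tm x n : ℝ) :
    ((indep fun _ : Fin m => p).bind M.output).expect (fun z =>
        oneSidedPotential l thr (aeVariance m σ) tm (x + z - (n + m) * (p true).toReal) (n + m))
      ≤ oneSidedPotential l thr (aeVariance m σ) tm (x - n * (p true).toReal) n := by
  have h := expect_exp_batch_le M σ hM p l
  have hm' : (m : ℝ) ≠ 0 := by positivity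
  have e : ∀ z : ℝ,
      oneSidedPotential l thr (aeVariance m σ) tm (x + z - (n + m) * (p true).toReal) (n + m)
      = ENNReal.ofReal (Real.exp (l * (x - n * (p true).toReal) - |l| * thr
          + (tm - (n + m)) * aeVariance m σ * l ^ 2 / 2)) *
        ENNReal.ofReal (Real.exp (l * (z - m * (p true).toReal))) := fun z => by
    rw [oneSidedPotential, ← ENNReal.ofReal_mul (Real.exp_pos _).le, ← Real.exp_add]
    congr 2; ring
  simp only [e, PMF.expect_const_mul]
  refine (mul_le_mul_right h _).trans (le_of_eq ?_)
  rw [oneSidedPotential, ← ENNReal.ofReal_mul (Real.exp_pos _).le, ← Real.exp_add]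
  congr 2
  unfold aeVariance
  field_simp
  ring

theorem expect_deviationPotential_le {m : ℕ} (hm : 0 < m) {Y : Type*} (M : ShuffleMechanism m Y)
    (σ : ℝ≥0) (hM : M.HasSubgaussianError σ) (p : PMF Bool) (T t : ℕ) (x n : ℝ) :
    ((indep fun _ : Fin m => p).bind M.output).expect (fun z =>
        deviationPotential m σ T t (x + z - (n + m) * (p true).toReal) (n + m))
      ≤ deviationPotential m σ T t (x - n * (p true).toReal) n := by
  simp only [deviationPotential, PMF.expect_add]
  exact add_le_add (expect_oneSidedPotential_le hm M σ hM p _ _ _ _ _)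
    (expect_oneSidedPotential_le hm M σ hM p _ _ _ _ _)

/-- At the end of phase `t` the potential dominates the indicator of a large deviation. -/
theorem one_le_deviationPotential (m : ℕ) (σ : ℝ≥0) (T t : ℕ) (y : ℝ)
    (hy : aeThreshold m σ T t < |y|) : 1 ≤ deviationPotential m σ T t y (t * m) := by
  have hl := aeExponent_nonneg m σ T t
  have aux : ∀ l : ℝ, 0 ≤ l * y - |l| * aeThreshold m σ T t →
      1 ≤ oneSidedPotential l (aeThreshold m σ T t) (aeVariance m σ) (t * m) y (t * m) := by
    intro l h
    rw [oneSidedPotential, ENNReal.one_le_ofReal, Real.one_le_exp_iff]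
    simpa using h
  unfold deviationPotential
  rcases lt_abs.1 hy with h | h
  · refine (aux _ ?_).trans le_self_add
    rw [abs_of_nonneg hl]; nlinarith
  · refine (aux _ ?_).trans le_add_self
    rw [abs_neg, abs_of_nonneg hl]; nlinarith

-- Passing from j to j + 1 completed batches drops exactly the term t = j + 1 from the potential.
-- That term dominates the indicator of a failure at this time; every other term is a
-- supermartingale.
open Classical in
theorem expect_armPotential_add_le {m : ℕ} (hm : 0 < m) {Y : Type*} (M : ShuffleMechanism m Y)
    (σ : ℝ≥0) (hM : M.HasSubgaussianError σ) (p : PMF Bool) (T j : ℕ) (x : ℝ) (hj : j + 1 ≤ T) :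
    ((indep fun _ : Fin m => p).bind M.output).expect (fun z =>
        armPotential m σ T (p true).toReal (x + z) (j * m + m) +
        if aeThreshold m σ T (j + 1) < |x + z - (j * m + m) * (p true).toReal| then 1 else 0)
      ≤ armPotential m σ T (p true).toReal x (j * m) := by
  have hs : (Finset.Icc 1 T).filter (fun t => j * m < t * m)
      = insert (j + 1) ((Finset.Icc 1 T).filter (fun t => j * m + m < t * m)) := by
    ext t
    have e : j * m + m = (j + 1) * m := by ring
    simp only [Finset.mem_filter, Finset.mem_insert, Finset.mem_Icc, e,
      Nat.mul_lt_mul_right hm]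
    omega
  have hn : (j + 1) ∉ (Finset.Icc 1 T).filter (fun t => j * m + m < t * m) := by
    simp [add_mul]
  rw [armPotential, hs, Finset.sum_insert hn, PMF.expect_add, add_comm]
  refine add_le_add ?_ ?_
  · refine le_trans (PMF.expect_mono _ fun z => ?_)
      (expect_deviationPotential_le hm M σ hM p T (j + 1) x ((j * m : ℕ) : ℝ))
    split_ifs with h
    · have := one_le_deviationPotential m σ T (j + 1) _ h
      rw [show ((j + 1 : ℕ) : ℝ) * m = j * m + m by push_cast; ring] at this
      push_cast
      exact this
    · exact zero_le
  · simp only [armPotential, PMF.expect_finset_sum]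
    refine Finset.sum_le_sum fun t _ => ?_
    have := expect_deviationPotential_le hm M σ hM p T t x ((j * m : ℕ) : ℝ)
    push_cast at this ⊢
    exact this

theorem armPotential_init_le {m : ℕ} (hm : 0 < m) (σ : ℝ≥0) (T : ℕ) (μ : ℝ) :
    armPotential m σ T μ 0 0 ≤ ENNReal.ofReal (2 * T * Real.exp (-4 * Real.log T)) := by
  have h1 : ∀ t ∈ (Finset.Icc 1 T).filter (fun t => 0 < t * m),
      deviationPotential m σ T t (0 - (0 : ℕ) * μ) (0 : ℕ)
        ≤ ENNReal.ofReal (2 * Real.exp (-4 * Real.log T)) := by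
    intro t ht
    have ht1 : 1 ≤ t := by simp at ht; omega
    have hT : 1 ≤ T := by simp at ht; omega
    have hm' : (0 : ℝ) < m := by positivity
    have ht' : (0 : ℝ) < t := by positivity
    have hlog : 0 ≤ Real.log T := Real.log_nonneg (by exact_mod_cast hT)
    have hv := aeVariance_pos m σ
    -- Drop the cross term in (2√t σ + √(tm))²; the rest is four times the variance proxy tm/4 + tσ²
    -- of t batches.
    have hthr : 8 * (t * m * aeVariance m σ) * Real.log T ≤ aeThreshold m σ T t ^ 2 := by
      have e : 8 * (t * m * aeVariance m σ) * Real.log T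
          = (4 * t * σ ^ 2 + t * m) * (2 * Real.log T) := by
        unfold aeVariance; field_simp; ring
      rw [e, aeThreshold, mul_pow, Real.sq_sqrt (by positivity)]
      refine mul_le_mul_of_nonneg_right ?_ (by positivity)
      have a1 := Real.sq_sqrt ht'.le
      have a2 := Real.sq_sqrt (mul_pos ht' hm').le
      have a3 : 0 ≤ √(t : ℝ) * σ * √((t : ℝ) * m) := by positivity
      nlinarith
    -- With threshold H, variance D and the optimal exponent H/D, the Chernoff exponent is −H²/(2D).
    have key : -aeExponent m σ T t * aeThreshold m σ T t
        + t * m * aeVariance m σ * aeExponent m σ T t ^ 2 / 2 ≤ -4 * Real.log T := by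
      have hD : 0 < t * m * aeVariance m σ := by positivity
      unfold aeExponent
      generalize t * m * aeVariance m σ = D at *
      generalize aeThreshold m σ T t = H at *
      have : -(H / D) * H + D * (H / D) ^ 2 / 2 = -(H ^ 2 / D) / 2 := by field_simp; ring
      rw [this]
      have : 8 * Real.log T ≤ H ^ 2 / D := by
        rw [le_div_iff₀ hD]; linarith
      linarith
    have hone : ∀ l : ℝ, |l| = aeExponent m σ T t →
        oneSidedPotential l (aeThreshold m σ T t) (aeVariance m σ) (t * m) (0 - (0 : ℕ) * μ) (0 : ℕ)
          ≤ ENNReal.ofReal (Real.exp (-4 * Real.log T)) := by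
      intro l hl
      refine ENNReal.ofReal_le_ofReal (Real.exp_le_exp.2 ?_)
      rw [← sq_abs l, hl]
      simp only [Nat.cast_zero, zero_mul, sub_zero, mul_zero]
      linarith
    have hl := aeExponent_nonneg m σ T t
    rw [two_mul, ENNReal.ofReal_add (Real.exp_pos _).le (Real.exp_pos _).le]
    exact add_le_add (hone _ (abs_of_nonneg hl)) (hone _ (by rw [abs_neg, abs_of_nonneg hl]))
  refine (Finset.sum_le_sum h1).trans ?_
  rw [Finset.sum_const, nsmul_eq_mul, mul_right_comm, mul_comm _ (T : ℝ),
    ENNReal.ofReal_mul (p := (T : ℝ)) (by positivity), ENNReal.ofReal_natCast]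
  refine mul_le_mul_left ?_ _
  have := Finset.card_filter_le (Finset.Icc 1 T) (fun t => 0 < t * m)
  rw [Nat.card_Icc] at this
  exact_mod_cast this

/-! ### The invariant of arm elimination on the good event -/

/-- Number of pulls after which a suboptimal arm must have been eliminated on the good event. -/
noncomputable def aePullBound {k : ℕ} (m : ℕ) (σ : ℝ) (T : ℕ) (ν : Fin k → PMF Bool)
    (a : Fin k) : ℝ :=
  64 * (4 * σ ^ 2 / m + 1) * Real.log T / gap ν a ^ 2

theorem aePullBound_nonneg {k : ℕ} (m : ℕ) (σ : ℝ) (T : ℕ) (ν : Fin k → PMF Bool) (a : Fin k) :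
    0 ≤ aePullBound m σ T ν a := by
  have := Real.log_natCast_nonneg T
  unfold aePullBound; positivity

theorem exists_optimal_arm {k : ℕ} [NeZero k] (ν : Fin k → PMF Bool) :
    ∃ o, ∀ a, gap ν a = meanReward ν o - meanReward ν a := by
  obtain ⟨o, ho⟩ := exists_eq_ciSup_of_finite (f := meanReward ν)
  exact ⟨o, fun a => by rw [gap, ho]⟩

theorem gap_nonneg {k : ℕ} (ν : Fin k → PMF Bool) (a : Fin k) : 0 ≤ gap ν a :=
  sub_nonneg.2 (le_ciSup (Set.finite_range _).bddAbove a)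

namespace AEState

variable {k : ℕ}

/-- What holds between two batches as long as all sums have stayed in their confidence intervals
at the ends of the batches. -/
structure Invariant (m : ℕ) (σ : ℝ) (T : ℕ) (ν : Fin k → PMF Bool) (s : AEState k) : Prop where
  nodup : s.queue.Nodup
  queue_subset : ∀ a ∈ s.queue, a ∈ s.viable
  phase_pos : 0 < s.phase
  pulls_of_mem_queue : ∀ a ∈ s.queue, s.N a + m = s.phase * m
  pulls_of_notMem_queue : ∀ a ∈ s.viable, a ∉ s.queue → s.N a = s.phase * m
  optimal_viable : ∀ a, gap ν a = 0 → a ∈ s.viable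
  deviation_le : ∀ a ∈ s.viable, a ∉ s.queue →
    |s.S a - s.N a * meanReward ν a| ≤ aeThreshold m σ T s.phase
  -- Survival of the previous phase only bounds (t − 1)m; the extra m is the batch of the current
  -- phase.
  phase_le : ∀ a ∈ s.viable, 0 < gap ν a → (s.phase : ℝ) * m ≤ m + aePullBound m σ T ν a
  pulls_le_of_notMem : ∀ a, a ∉ s.viable → 0 < gap ν a → (s.N a : ℝ) ≤ m + aePullBound m σ T ν a

theorem invariant_init (m : ℕ) (σ : ℝ) (T : ℕ) (ν : Fin k → PMF Bool) :
    (init k).Invariant m σ T ν where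
  nodup := List.nodup_finRange k
  queue_subset := fun a _ => Finset.mem_univ a
  phase_pos := one_pos
  pulls_of_mem_queue := fun a _ => by simp [init]
  pulls_of_notMem_queue := fun a _ h => absurd (List.mem_finRange a) h
  optimal_viable := fun a _ => Finset.mem_univ a
  deviation_le := fun a _ h => absurd (List.mem_finRange a) h
  phase_le := fun a _ _ => by simpa [init] using aePullBound_nonneg m σ T ν a
  pulls_le_of_notMem := fun a h => absurd (Finset.mem_univ a) h

theorem Invariant.pulls_le {m : ℕ} {σ : ℝ} {T : ℕ} {ν : Fin k → PMF Bool} {s : AEState k}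
    (h : s.Invariant m σ T ν) {a : Fin k} (ha : 0 < gap ν a) :
    (s.N a : ℝ) ≤ m + aePullBound m σ T ν a := by
  by_cases hv : a ∈ s.viable
  · refine le_trans ?_ (h.phase_le a hv ha)
    by_cases hq : a ∈ s.queue
    · exact_mod_cast (Nat.le_add_right _ m).trans (h.pulls_of_mem_queue a hq).le
    · exact_mod_cast (h.pulls_of_notMem_queue a hv hq).le
  · exact h.pulls_le_of_notMem a hv ha

/-- Translates between averages, on which elimination is defined, and sums, on which the potential
is defined. -/
theorem width_mul_pulls {m : ℕ} (hm : 0 < m) (σ : ℝ) (T : ℕ) (s : AEState k) (a : Fin k)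
    (hp : 0 < s.phase) (hN : s.N a = s.phase * m) :
    s.width σ T a * s.N a = aeThreshold m σ T s.phase := by
  have hpos : (0 : ℝ) < s.N a := by rw [hN]; positivity
  have hsq : √(s.N a : ℝ) * √(s.N a : ℝ) = s.N a := Real.mul_self_sqrt hpos.le
  have hs : √(s.N a : ℝ) ≠ 0 := (Real.sqrt_pos.2 hpos).ne'
  have hc : √(s.N a : ℝ) = √((s.phase : ℝ) * m) := by rw [hN]; push_cast; rfl
  rw [width, aeThreshold, ← hc]
  have : 1 / √(s.N a : ℝ) * s.N a = √(s.N a : ℝ) := by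
    rw [div_mul_eq_mul_div, one_mul, div_eq_iff hs, hsq]
  calc _ = (2 * √(s.phase : ℝ) * σ / s.N a * s.N a + 1 / √(s.N a : ℝ) * s.N a)
        * √(2 * Real.log T) := by ring
    _ = _ := by rw [this, div_mul_cancel₀ _ hpos.ne']

theorem Invariant.abs_average_sub_le {m : ℕ} (hm : 0 < m) {σ : ℝ} {T : ℕ} {ν : Fin k → PMF Bool}
    {s : AEState k} (h : s.Invariant m σ T ν) (hq : s.queue = []) {a : Fin k}
    (ha : a ∈ s.viable) : |s.S a / s.N a - meanReward ν a| ≤ s.width σ T a := by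
  have hnq : a ∉ s.queue := by simp [hq]
  have hN := h.pulls_of_notMem_queue a ha hnq
  have hpos : (0 : ℝ) < s.N a := by
    have := h.phase_pos
    rw [hN]; positivity
  have hd := h.deviation_le a ha hnq
  rw [← width_mul_pulls hm σ T s a h.phase_pos hN] at hd
  rw [← mul_le_mul_iff_left₀ hpos]
  refine le_trans (le_of_eq ?_) hd
  rw [← abs_of_pos hpos, ← abs_mul, abs_of_pos hpos, sub_mul, div_mul_cancel₀ _ hpos.ne',
    mul_comm (meanReward ν a)]

/-- An arm whose gap is small compared with the confidence intervals has not been pulled often. -/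
theorem phase_mul_le_of_gap_le {m : ℕ} (hm : 0 < m) (σ : ℝ≥0) (T t : ℕ) (ht : 0 < t)
    (ν : Fin k → PMF Bool) (a : Fin k) (ha : 0 < gap ν a)
    (h : gap ν a * (t * m) ≤ 4 * aeThreshold m σ T t) : (t : ℝ) * m ≤ aePullBound m σ T ν a := by
  have hlog := Real.log_natCast_nonneg T
  have hm' : (0 : ℝ) < m := by positivity
  have ht' : (0 : ℝ) < t := by positivity
  -- This is (x + y)² ≤ 2(x² + y²). Together with the factor 4² from four half-widths it gives the
  -- 64 in `aePullBound`.
  have hthr : aeThreshold m σ T t ^ 2 ≤ 4 * (t * m) * ((4 * σ ^ 2 / m + 1) * Real.log T) := by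
    have e : 4 * (t * m) * ((4 * (σ : ℝ) ^ 2 / m + 1) * Real.log T)
        = 2 * (4 * t * σ ^ 2 + t * m) * (2 * Real.log T) := by field_simp; ring
    rw [e, aeThreshold, mul_pow, Real.sq_sqrt (x := 2 * Real.log T) (by positivity)]
    refine mul_le_mul_of_nonneg_right ?_ (by positivity)
    have a1 := Real.sq_sqrt ht'.le
    have a2 := Real.sq_sqrt (mul_pos ht' hm').le
    have a3 := sq_nonneg (2 * √(t : ℝ) * σ - √((t : ℝ) * m))
    nlinarith
  rw [aePullBound, le_div_iff₀ (by positivity)]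
  have h2 : (gap ν a * (t * m)) ^ 2 ≤ (4 * aeThreshold m σ T t) ^ 2 :=
    pow_le_pow_left₀ (by positivity) h 2
  have h3 : 0 < (t : ℝ) * m := by positivity
  rw [← mul_le_mul_iff_left₀ h3]
  nlinarith

theorem Invariant.endPhase {m : ℕ} (hm : 0 < m) [NeZero k] {σ : ℝ≥0} {T : ℕ}
    {ν : Fin k → PMF Bool} {s : AEState k} (h : s.Invariant m σ T ν) (hq : s.queue = []) :
    (s.endPhase σ T).Invariant m σ T ν ∧ (s.endPhase σ T).queue ≠ [] := by
  classical
  obtain ⟨o, ho⟩ := exists_optimal_arm ν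
  have hN : ∀ a ∈ s.viable, s.N a = s.phase * m := fun a ha =>
    h.pulls_of_notMem_queue a ha (by simp [hq])
  have hsub : ∀ a ∈ (s.endPhase σ T).viable, a ∈ s.viable := fun a ha =>
    (Finset.mem_filter.1 ha).1
  have hqueue : ∀ a, a ∈ (s.endPhase σ T).queue ↔ a ∈ (s.endPhase σ T).viable := fun a => by
    simp [AEState.endPhase]
  have hopt : ∀ a, gap ν a = 0 → a ∈ (s.endPhase σ T).viable := by
    intro a ha
    refine Finset.mem_filter.2 ⟨h.optimal_viable a ha, ?_⟩
    rintro ⟨b, hb, hlt⟩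
    have h1 := abs_le.1 (h.abs_average_sub_le hm hq (h.optimal_viable a ha))
    have h2 := abs_le.1 (h.abs_average_sub_le hm hq hb)
    have h3 := gap_nonneg ν b
    have h4 := ho a
    have h5 := ho b
    unfold ucb lcb at hlt
    linarith
  have hov : o ∈ (s.endPhase σ T).viable := hopt o (by rw [ho, sub_self])
  refine ⟨⟨?_, fun a => (hqueue a).1, Nat.succ_pos _, ?_, ?_, hopt, ?_, ?_, ?_⟩, ?_⟩
  · exact (List.nodup_finRange k).filter _
  · intro a ha
    change s.N a + m = (s.phase + 1) * m
    rw [hN a (hsub a ((hqueue a).1 ha))]; ring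
  · exact fun a ha hna => absurd ((hqueue a).2 ha) hna
  · exact fun a ha hna => absurd ((hqueue a).2 ha) hna
  · intro a ha hgap
    have hav := hsub a ha
    have hnot := (Finset.mem_filter.1 ha).2
    -- In particular the optimal arm `o` does not eliminate `a`; both have the same width, and each
    -- average errs by at most one width.
    have hle := not_lt.1 fun hlt => hnot ⟨o, hsub o hov, hlt⟩
    have h1 := abs_le.1 (h.abs_average_sub_le hm hq hav)
    have h2 := abs_le.1 (h.abs_average_sub_le hm hq (hsub o hov))
    have hw : s.width σ T o = s.width σ T a := by
      unfold width; rw [hN a hav, hN o (hsub o hov)]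
    have hthr := width_mul_pulls hm σ T s a h.phase_pos (hN a hav)
    have hgw : gap ν a ≤ 4 * s.width σ T a := by
      rw [ho a]; unfold ucb lcb at hle; linarith
    have := phase_mul_le_of_gap_le hm σ T s.phase h.phase_pos ν a hgap (by
      rw [← hthr, hN a hav]
      push_cast
      rw [← mul_assoc 4]
      exact mul_le_mul_of_nonneg_right hgw (by positivity))
    change ((s.phase + 1 : ℕ) : ℝ) * m ≤ _
    push_cast
    linarith
  · intro a ha hgap
    exact h.pulls_le hgap
  · exact List.ne_nil_of_mem ((hqueue o).2 hov)

theorem Invariant.serve {m : ℕ} {σ : ℝ} {T : ℕ}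
    {ν : Fin k → PMF Bool} {s : AEState k} (h : s.Invariant m σ T ν) {b : Fin k}
    {rest : List (Fin k)} (hq : s.queue = b :: rest) (z : ℝ)
    (hz : |s.S b + z - (s.N b + m) * meanReward ν b| ≤ aeThreshold m σ T s.phase) :
    ({ s with queue := rest, S := s.S + Pi.single b z, N := s.N + Pi.single b m } :
      AEState k).Invariant m σ T ν := by
  have hnd := h.nodup
  rw [hq, List.nodup_cons] at hnd
  have hb : b ∈ s.queue := by simp [hq]
  have hrest : ∀ a ∈ rest, a ∈ s.queue ∧ a ≠ b := fun a ha =>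
    ⟨by simp [hq, ha], fun e => hnd.1 (e ▸ ha)⟩
  have hNb := h.pulls_of_mem_queue b hb
  have hout : ∀ a, a ∉ rest → a ≠ b → a ∉ s.queue := fun a h1 h2 => by simp [hq, h1, h2]
  refine ⟨hnd.2, fun a ha => h.queue_subset a (hrest a ha).1, h.phase_pos, ?_, ?_,
    h.optimal_viable, ?_, h.phase_le, ?_⟩
  · intro a ha
    simpa [(hrest a ha).2] using h.pulls_of_mem_queue a (hrest a ha).1
  · intro a ha hna
    by_cases e : a = b
    · subst e; simpa using hNb
    · simpa [e] using h.pulls_of_notMem_queue a ha (hout a hna e)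
  · intro a ha hna
    by_cases e : a = b
    · subst e; simpa using hz
    · simpa [e] using h.deviation_le a ha (hout a hna e)
  · intro a ha hgap
    have e : a ≠ b := fun e => ha (e ▸ h.queue_subset b hb)
    simpa [e] using h.pulls_le_of_notMem a ha hgap

theorem Invariant.update {m : ℕ} (hm : 0 < m) [NeZero k] {σ : ℝ≥0} {T : ℕ}
    {ν : Fin k → PMF Bool} {s : AEState k} (h : s.Invariant m σ T ν) {b : Fin k}
    {rest : List (Fin k)} (hq : s.queue = b :: rest) (z : ℝ)
    (hz : |s.S b + z - (s.N b + m) * meanReward ν b| ≤ aeThreshold m σ T s.phase) :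
    (s.update m σ T z).Invariant m σ T ν ∧ (s.update m σ T z).queue ≠ [] := by
  have hs := h.serve hq z hz
  unfold AEState.update
  rw [hq]
  cases rest with
  | nil => exact hs.endPhase hm rfl
  | cons c rest => exact ⟨hs, by simp⟩

theorem update_S {m : ℕ} {σ : ℝ} {T : ℕ} {s : AEState k} {b : Fin k}
    {rest : List (Fin k)} (hq : s.queue = b :: rest) (z : ℝ) :
    (s.update m σ T z).S = s.S + Pi.single b z := by
  unfold AEState.update
  rw [hq]
  cases rest <;> rfl

theorem update_N {m : ℕ} {σ : ℝ} {T : ℕ} {s : AEState k} {b : Fin k}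
    {rest : List (Fin k)} (hq : s.queue = b :: rest) (z : ℝ) :
    (s.update m σ T z).N = s.N + Pi.single b m := by
  unfold AEState.update
  rw [hq]
  cases rest <;> rfl

end AEState

/-! ### Expected numbers of pulls -/

namespace Policy

variable {k : ℕ} {Y : Type*}

theorem expect_sum_runFrom_le (π : Policy k Y) (ν : Fin k → PMF Bool) :
    ∀ (r n : ℕ) (h : List ℝ) (N : Fin k → ℕ),
      (π.runFrom ν r n h N).expect (fun N' => ((∑ a, N' a : ℕ) : ℝ≥0∞))
        ≤ ((∑ a, N a + n : ℕ) : ℝ≥0∞)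
  | 0, n, h, N => by
    rw [runFrom, PMF.expect_pure]
    exact_mod_cast Nat.le_add_right _ _
  | r + 1, n, h, N => by
    rw [runFrom]
    split_ifs with hn
    · rw [PMF.expect_pure]
      simp [Finset.sum_add_distrib]
    · rw [PMF.expect_bind]
      refine (PMF.expect_mono _ fun z => expect_sum_runFrom_le π ν r _ _ _).trans ?_
      rw [PMF.expect_const]
      refine Nat.cast_le.2 ?_
      simp only [Pi.add_apply, Finset.sum_add_distrib, Finset.sum_pi_single', Finset.mem_univ,
        if_true]
      have := Finset.sum_pi_single' (π h).arm (π h).size Finset.univ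
      simp only [Finset.mem_univ, if_true] at this
      simp only [Pi.single_apply] at this ⊢
      simp
      omega

theorem expect_runFrom_le (π : Policy k Y) (ν : Fin k → PMF Bool) (r n : ℕ) (h : List ℝ)
    (N : Fin k → ℕ) (a : Fin k) :
    (π.runFrom ν r n h N).expect (fun N' => (N' a : ℝ≥0∞)) ≤ ((∑ a, N a + n : ℕ) : ℝ≥0∞) :=
  (PMF.expect_mono _ fun _ => Nat.cast_le.2
    (Finset.single_le_sum (fun _ _ => Nat.zero_le _) (Finset.mem_univ a))).trans
    (expect_sum_runFrom_le π ν r n h N)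

end Policy

/-! ### The potential argument along a run of arm elimination -/

section ArmElimination

variable {k m : ℕ} {Y : Type*}

/-- The state of arm elimination after the outputs `h`. -/
noncomputable def aeState (k m : ℕ) (σ : ℝ) (T : ℕ) (h : List ℝ) : AEState k :=
  h.foldl (AEState.update m σ T) (AEState.init k)

theorem aeState_append_singleton (σ : ℝ) (T : ℕ) (h : List ℝ) (z : ℝ) :
    aeState k m σ T (h ++ [z]) = (aeState k m σ T h).update m σ T z := by
  simp [aeState]

theorem sdpAE_runFrom_succ [NeZero k] (M : ShuffleMechanism m Y) (σ : ℝ) (T : ℕ)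
    (ν : Fin k → PMF Bool) (r n : ℕ) (h : List ℝ) (N : Fin k → ℕ) {b : Fin k} {rest : List (Fin k)}
    (hq : (aeState k m σ T h).queue = b :: rest) :
    (sdpAE k M σ T).runFrom ν (r + 1) n h N =
      if n ≤ m then PMF.pure (N + Pi.single b n)
      else ((indep fun _ : Fin m => ν b).bind M.output).bind fun z =>
        (sdpAE k M σ T).runFrom ν r (n - m) (h ++ [z]) (N + Pi.single b m) := by
  have hb : ((sdpAE k M σ T) h).arm = b := by
    change (aeState k m σ T h).queue.headD 0 = b
    rw [hq]; rfl
  rw [Policy.runFrom, hb]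
  rfl

/-- Upper bound for the probability that some sum will leave its confidence interval. -/
noncomputable def aePotential (m : ℕ) (σ : ℝ) (T : ℕ) (ν : Fin k → PMF Bool) (s : AEState k) :
    ℝ≥0∞ :=
  ∑ a, armPotential m σ T (meanReward ν a) (s.S a) (s.N a)

open Classical in
theorem expect_aePotential_update_le (hm : 0 < m) (M : ShuffleMechanism m Y) (σ : ℝ≥0)
    (hM : M.HasSubgaussianError σ) (T j : ℕ) (ν : Fin k → PMF Bool) (s : AEState k) {b : Fin k}
    {rest : List (Fin k)} (hq : s.queue = b :: rest) (hj : s.N b = j * m) (hjT : j + 1 ≤ T) :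
    ((indep fun _ : Fin m => ν b).bind M.output).expect (fun z =>
        aePotential m σ T ν (s.update m σ T z) +
        if aeThreshold m σ T (j + 1) < |s.S b + z - (s.N b + m) * meanReward ν b| then 1 else 0)
      ≤ aePotential m σ T ν s := by
  have e : ∀ z, aePotential m σ T ν (s.update m σ T z) =
      armPotential m σ T (meanReward ν b) (s.S b + z) (j * m + m) +
      ∑ a ∈ Finset.univ.erase b, armPotential m σ T (meanReward ν a) (s.S a) (s.N a) := fun z => by
    rw [aePotential, ← Finset.add_sum_erase _ _ (Finset.mem_univ b), AEState.update_S hq,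
      AEState.update_N hq]
    congr 1
    · simp [hj]
    · refine Finset.sum_congr rfl fun a ha => ?_
      simp [Finset.ne_of_mem_erase ha]
  simp only [e, add_right_comm]
  rw [PMF.expect_add, PMF.expect_const, aePotential,
    ← Finset.add_sum_erase _ _ (Finset.mem_univ b)]
  refine add_le_add_left ?_ _
  have := expect_armPotential_add_le hm M σ hM (ν b) T j (s.S b) hjT
  simpa [hj, meanReward] using this

/-- Induction over rounds. If the interval of the served arm fails after a batch, the invariant is
abandoned and the pulls are bounded by T, which the drop of the potential pays for on average;
otherwise the invariant persists. -/
theorem expect_sdpAE_runFrom_le [NeZero k] (hm : 0 < m) (M : ShuffleMechanism m Y) (σ : ℝ≥0)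
    (hM : M.HasSubgaussianError σ) (T : ℕ) (ν : Fin k → PMF Bool) (a : Fin k)
    (ha : 0 < gap ν a) :
    ∀ (r n : ℕ) (h : List ℝ), (aeState k m σ T h).Invariant m σ T ν →
      (aeState k m σ T h).queue ≠ [] → ∑ c, (aeState k m σ T h).N c + n ≤ T →
      ((sdpAE k M σ T).runFrom ν r n h (aeState k m σ T h).N).expect (fun N' => (N' a : ℝ≥0∞))
        ≤ ENNReal.ofReal (m + aePullBound m σ T ν a) +
          T * aePotential m σ T ν (aeState k m σ T h)
  | 0, n, h, hI, hq, hT => by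
    rw [Policy.runFrom, PMF.expect_pure]
    refine le_trans ?_ le_self_add
    rw [← ENNReal.ofReal_natCast]
    exact ENNReal.ofReal_le_ofReal (hI.pulls_le ha)
  | r + 1, n, h, hI, hq, hT => by
    classical
    obtain ⟨b, rest, hbr⟩ := List.exists_cons_of_ne_nil hq
    have hbq : b ∈ (aeState k m σ T h).queue := by simp [hbr]
    have hNb := hI.pulls_of_mem_queue b hbq
    rw [sdpAE_runFrom_succ M σ T ν r n h _ hbr]
    split_ifs with hn
    · rw [PMF.expect_pure]
      refine le_trans ?_ le_self_add
      rw [← ENNReal.ofReal_natCast]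
      refine ENNReal.ofReal_le_ofReal ?_
      by_cases e : a = b
      · subst e
        refine le_trans ?_ (hI.phase_le a (hI.queue_subset a hbq) ha)
        rw [Pi.add_apply, Pi.single_eq_same]
        exact_mod_cast (Nat.add_le_add_left hn _).trans hNb.le
      · simpa [e] using hI.pulls_le ha
    · obtain ⟨j, hj⟩ : ∃ j, (aeState k m σ T h).phase = j + 1 :=
        ⟨_, (Nat.succ_pred_eq_of_pos hI.phase_pos).symm⟩
      have hNj : (aeState k m σ T h).N b = j * m := by
        rw [hj, add_mul, one_mul] at hNb; omega
      have hle : (aeState k m σ T h).N b ≤ ∑ c, (aeState k m σ T h).N c :=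
        Finset.single_le_sum (fun _ _ => Nat.zero_le _) (Finset.mem_univ b)
      -- The whole batch fits into the remaining users, so (j + 1)m ≤ T. Thus phase j + 1 occurs in
      -- the potential, which stops at phase T.
      have hjT : j + 1 ≤ T := by
        refine le_trans ?_ hT
        nlinarith
      have hN' : ∀ z, (aeState k m σ T h).N + Pi.single b m = (aeState k m σ T (h ++ [z])).N :=
        fun z => by rw [aeState_append_singleton, AEState.update_N hbr]
      have hsum : ∑ c, ((aeState k m σ T h).N + Pi.single b m : Fin k → ℕ) c + (n - m) ≤ T := by
        simp [Finset.sum_add_distrib]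
        omega
      have hstep : ∀ z,
          ((sdpAE k M σ T).runFrom ν r (n - m) (h ++ [z])
            ((aeState k m σ T h).N + Pi.single b m)).expect (fun N' => (N' a : ℝ≥0∞))
          ≤ ENNReal.ofReal (m + aePullBound m σ T ν a) + T *
            (aePotential m σ T ν ((aeState k m σ T h).update m σ T z) +
              if aeThreshold m σ T (j + 1) < |(aeState k m σ T h).S b + z -
                ((aeState k m σ T h).N b + m) * meanReward ν b| then 1 else 0) := fun z => by
        split_ifs with hz
        · refine (Policy.expect_runFrom_le _ ν r _ _ _ a).trans ?_
          refine (Nat.cast_le.2 hsum).trans (le_trans ?_ le_add_self)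
          rw [mul_add, mul_one]
          exact le_add_self
        · have hup := hI.update hm hbr z (by rw [hj]; exact not_lt.1 hz)
          rw [← aeState_append_singleton] at hup
          have ih := expect_sdpAE_runFrom_le hm M σ hM T ν a ha r (n - m) (h ++ [z]) hup.1 hup.2
            (by rw [← hN' z]; exact hsum)
          rw [← hN' z, aeState_append_singleton] at ih
          rwa [add_zero]
      rw [PMF.expect_bind]
      refine (PMF.expect_mono _ hstep).trans ?_
      rw [PMF.expect_add, PMF.expect_const, PMF.expect_const_mul]
      exact add_le_add_right (mul_le_mul_right
        (expect_aePotential_update_le hm M σ hM T j ν _ hbr hNj hjT) _) _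

/-- If there are not enough users for a full first phase, every arm is pulled at most `m` times. -/
theorem expect_sdpAE_runFrom_le_size [NeZero k] (hm : 0 < m) (M : ShuffleMechanism m Y) (σ : ℝ)
    (T : ℕ) (ν : Fin k → PMF Bool) (a : Fin k) :
    ∀ (r n : ℕ) (h : List ℝ), (aeState k m σ T h).queue.Nodup →
      (aeState k m σ T h).queue ≠ [] → n ≤ (aeState k m σ T h).queue.length →
      (∀ c ∈ (aeState k m σ T h).queue, (aeState k m σ T h).N c = 0) →
      (∀ c, (aeState k m σ T h).N c ≤ m) →
      ((sdpAE k M σ T).runFrom ν r n h (aeState k m σ T h).N).expect (fun N' => (N' a : ℝ≥0∞))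
        ≤ m
  | 0, n, h, hnd, hq, hn, h0, hN => by
    rw [Policy.runFrom, PMF.expect_pure]
    exact_mod_cast hN a
  | r + 1, n, h, hnd, hq, hn, h0, hN => by
    obtain ⟨b, rest, hbr⟩ := List.exists_cons_of_ne_nil hq
    rw [hbr] at hnd hn
    have hb0 : (aeState k m σ T h).N b = 0 := h0 b (by simp [hbr])
    have hpull : ∀ l ≤ m, ∀ c, ((aeState k m σ T h).N + Pi.single b l : Fin k → ℕ) c ≤ m := by
      intro l hl c
      by_cases e : c = b
      · subst e; simpa [hb0] using hl
      · simpa [e] using hN c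
    rw [sdpAE_runFrom_succ M σ T ν r n h _ hbr]
    split_ifs with hnm
    · rw [PMF.expect_pure]
      exact_mod_cast hpull n hnm a
    · rw [PMF.expect_bind]
      refine (PMF.expect_mono _ fun z => ?_).trans (PMF.expect_const _ _).le
      -- More than m ≥ 1 users are left, but no more than arms in the queue, so another arm is
      -- waiting and the phase does not end here.
      obtain ⟨c, rest', rfl⟩ : ∃ c rest', rest = c :: rest' := by
        refine List.exists_cons_of_ne_nil ?_
        rintro rfl
        simp at hn; omega
      have hN' : (aeState k m σ T h).N + Pi.single b m = (aeState k m σ T (h ++ [z])).N := by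
        rw [aeState_append_singleton, AEState.update_N hbr]
      have hq' : (aeState k m σ T (h ++ [z])).queue = c :: rest' := by
        rw [aeState_append_singleton, AEState.update, hbr]; rfl
      rw [hN']
      refine expect_sdpAE_runFrom_le_size hm M σ T ν a r (n - m) (h ++ [z]) ?_ ?_ ?_ ?_ ?_
      · rw [hq']; exact (List.nodup_cons.1 hnd).2
      · rw [hq']; simp
      · rw [hq']; simp at hn ⊢; omega
      · intro d hd
        rw [hq'] at hd
        have hdb : d ≠ b := fun e => (List.nodup_cons.1 hnd).1 (e ▸ hd)
        rw [← hN']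
        simpa [hdb] using h0 d (by rw [hbr]; exact List.mem_cons_of_mem _ hd)
      · rw [← hN']; exact hpull m le_rfl

theorem expect_sdpAE_pulls_le [NeZero k] (hm : 0 < m) (M : ShuffleMechanism m Y) (σ : ℝ≥0)
    (hM : M.HasSubgaussianError σ) (T : ℕ) (ν : Fin k → PMF Bool) (a : Fin k)
    (ha : 0 < gap ν a) :
    ((sdpAE k M σ T).pulls ν T).expect (fun N => (N a : ℝ≥0∞))
      ≤ ENNReal.ofReal (m + 2 + aePullBound m σ T ν a) := by
  have hb := aePullBound_nonneg m σ T ν a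
  -- The failure cost 2kT²·T⁻⁴ is bounded by a constant only if k is not large compared with T.
  rcases le_total T k with hTk | hkT
  · refine (expect_sdpAE_runFrom_le_size hm M σ T ν a T T [] (List.nodup_finRange k) ?_ ?_ ?_
      ?_).trans ?_
    · simp [aeState, AEState.init, NeZero.ne k]
    · simpa [aeState, AEState.init] using hTk
    · simp [aeState, AEState.init]
    · simp [aeState, AEState.init]
    · rw [← ENNReal.ofReal_natCast]
      exact ENNReal.ofReal_le_ofReal (by linarith)
  · have h := expect_sdpAE_runFrom_le hm M σ hM T ν a ha T T [] (AEState.invariant_init m σ T ν)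
      (by simp [aeState, AEState.init, NeZero.ne k]) (by simp [aeState, AEState.init])
    refine h.trans ?_
    rw [show (m : ℝ) + 2 + aePullBound m σ T ν a = m + aePullBound m σ T ν a + 2 by ring,
      ENNReal.ofReal_add (p := m + _) (by positivity) (by norm_num)]
    refine add_le_add_right ?_ _
    have h1 : aePotential m σ T ν (aeState k m σ T [])
        ≤ ENNReal.ofReal (k * (2 * T * Real.exp (-4 * Real.log T))) := by
      refine (Finset.sum_le_sum fun a _ => armPotential_init_le hm σ T _).trans ?_
      rw [Finset.sum_const, nsmul_eq_mul, ENNReal.ofReal_mul (p := (k : ℝ)) (by positivity),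
        ENNReal.ofReal_natCast]
      simp
    refine (mul_le_mul_right h1 _).trans ?_
    rw [← ENNReal.ofReal_natCast, ← ENNReal.ofReal_mul (by positivity)]
    refine ENNReal.ofReal_le_ofReal ?_
    have hT : (1 : ℝ) ≤ T := by
      have := NeZero.pos k
      exact_mod_cast (show 1 ≤ T by omega)
    have hT0 : (0 : ℝ) < T := by linarith
    have hexp : Real.exp (-4 * Real.log T) * T ^ 4 = 1 := by
      rw [← Real.exp_log hT0, ← Real.exp_nat_mul, ← Real.exp_add, Real.exp_log hT0]
      simp
    have hk : (k : ℝ) ≤ T := by exact_mod_cast hkT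
    have he := Real.exp_pos (-4 * Real.log T)
    calc (T : ℝ) * (k * (2 * T * Real.exp (-4 * Real.log T)))
        ≤ T * (T * (2 * T * Real.exp (-4 * Real.log T))) := by gcongr
      _ ≤ T * (T * (2 * T * Real.exp (-4 * Real.log T))) * T :=
          le_mul_of_one_le_right (by positivity) hT
      _ = 2 * (Real.exp (-4 * Real.log T) * T ^ 4) := by ring
      _ ≤ 2 := by rw [hexp]; norm_num

end ArmElimination

/-! ### Regret bounds -/

theorem regret_eq_sum {k : ℕ} {Y : Type*} (π : Policy k Y) (ν : Fin k → PMF Bool) (T : ℕ) :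
    regret π ν T
      = ∑ a, ((π.pulls ν T).expect (fun N => (N a : ℝ≥0∞))).toReal * gap ν a := by
  have hfin : ∀ a, (π.pulls ν T).expect (fun N => (N a : ℝ≥0∞)) ≠ ⊤ := fun a =>
    ((Policy.expect_runFrom_le π ν T T [] 0 a).trans_lt (ENNReal.natCast_lt_top _)).ne
  have hl : ∀ a, ∫⁻ N : Fin k → ℕ, ENNReal.ofReal (N a : ℝ) ∂(π.pulls ν T).toMeasure
      = (π.pulls ν T).expect (fun N => (N a : ℝ≥0∞)) := fun a => by
    rw [PMF.lintegral_toMeasure _ (Measurable.of_discrete)]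
    simp
  have hi : ∀ a, Integrable (fun N : Fin k → ℕ => (N a : ℝ)) (π.pulls ν T).toMeasure := fun a => by
    refine ⟨Measurable.of_discrete.aestronglyMeasurable, ?_⟩
    rw [hasFiniteIntegral_iff_ofReal (Filter.Eventually.of_forall fun _ => Nat.cast_nonneg _), hl]
    exact (hfin a).lt_top
  rw [regret, integral_finsetSum _ fun a _ => (hi a).mul_const _]
  refine Finset.sum_congr rfl fun a _ => ?_
  rw [integral_mul_const, integral_eq_lintegral_of_nonneg_ae
    (Filter.Eventually.of_forall fun _ => Nat.cast_nonneg _) (hi a).1, hl]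

theorem sum_expect_pulls_le {k : ℕ} {Y : Type*} (π : Policy k Y) (ν : Fin k → PMF Bool) (T : ℕ) :
    ∑ a, ((π.pulls ν T).expect (fun N => (N a : ℝ≥0∞))).toReal ≤ T := by
  have hfin : ∀ a, (π.pulls ν T).expect (fun N => (N a : ℝ≥0∞)) ≠ ⊤ := fun a =>
    ((Policy.expect_runFrom_le π ν T T [] 0 a).trans_lt (ENNReal.natCast_lt_top _)).ne
  rw [← ENNReal.toReal_sum fun a _ => hfin a, ← PMF.expect_finset_sum]
  have h := Policy.expect_sum_runFrom_le π ν T T [] 0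
  simp only [Pi.zero_apply, Finset.sum_const_zero, zero_add, Nat.cast_sum] at h
  exact ENNReal.toReal_mono (ENNReal.natCast_ne_top _) h

/-- A gap-free bound from a bound on the numbers of pulls in terms of the gaps. -/
theorem mul_gap_le_of_pulls_le {e g B A l k T : ℝ} (hg : 0 < g) (he : 0 ≤ e) (hB : 0 ≤ B)
    (hA : 0 ≤ A) (hl : 0 ≤ l) (hk : 0 < k) (hT : 0 < T) (hg1 : g ≤ 1)
    (h : e ≤ B + A * l / g ^ 2) :
    e * g ≤ e / T * √(k * T * l) + (B + A * (√(k * T * l) / k)) := by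
  have hw : √(k * T * l) ^ 2 = k * T * l := Real.sq_sqrt (by positivity)
  have hw0 := Real.sqrt_nonneg (k * T * l)
  generalize √(k * T * l) = w at *
  -- Small gaps are charged per pull and large gaps per arm; summed over arms, each kind contributes
  -- O(√(kTl)), apart from the terms `B`.
  rcases le_total (g ^ 2 * T) (k * l) with hc | hc
  · have h1 : g ≤ w / T := by
      rw [le_div_iff₀ hT]
      refine abs_le_of_sq_le_sq' ?_ hw0 |>.2
      nlinarith
    have h2 : e * g ≤ e / T * w := by
      rw [div_mul_eq_mul_div, ← mul_div_assoc']
      exact mul_le_mul_of_nonneg_left h1 he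
    have : 0 ≤ B + A * (w / k) := by positivity
    linarith
  · have h1 : l / g ≤ w / k := by
      rw [div_le_div_iff₀ hg hk]
      refine abs_le_of_sq_le_sq' ?_ (by positivity) |>.2
      have : (l * k) * (k * l) ≤ (l * k) * (g ^ 2 * T) := by gcongr
      nlinarith
    have h2 : e * g ≤ B * g + A * (l / g) := by
      refine (mul_le_mul_of_nonneg_right h hg.le).trans (le_of_eq ?_)
      field_simp
    have h3 : B * g ≤ B := mul_le_of_le_one_right hB hg1
    have h4 : A * (l / g) ≤ A * (w / k) := by gcongr
    have h5 : 0 ≤ e / T * w := by positivity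
    linarith

theorem meanReward_le_one {k : ℕ} (ν : Fin k → PMF Bool) (a : Fin k) : meanReward ν a ≤ 1 :=
  ENNReal.toReal_le_of_le_ofReal one_pos.le (by simpa using PMF.coe_le_one _ _)

theorem gap_le_one {k : ℕ} [NeZero k] (ν : Fin k → PMF Bool) (a : Fin k) : gap ν a ≤ 1 := by
  have : 0 ≤ meanReward ν a := ENNReal.toReal_nonneg
  have := ciSup_le (meanReward_le_one ν)
  unfold gap; linarith

theorem sdpAE_regret_le {c₁ c₂ c₃ L : ℝ} (hc₁ : 0 < c₁) (hc₂ : 0 < c₂) (hc₃ : 0 < c₃) (hL : 0 < L)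
    {m : ℕ} (hm₁ : c₁ * L ≤ m) (hm₂ : m ≤ c₂ * L) {σ : ℝ≥0} (hσ : (σ : ℝ) ^ 2 ≤ c₃ * L)
    {Y : Type*} (M : ShuffleMechanism m Y) (hM : M.HasSubgaussianError σ) (k : ℕ) [NeZero k]
    (T : ℕ) (ν : Fin k → PMF Bool) :
    regret (sdpAE k M σ T) ν T
        ≤ (3 * c₂ + (64 * (4 * (c₃ / c₁) + 1) + 1)) * ∑ a with 0 < gap ν a,
            (Real.log T / gap ν a + gap ν a * L) ∧
      regret (sdpAE k M σ T) ν T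
        ≤ (3 * c₂ + (64 * (4 * (c₃ / c₁) + 1) + 1)) *
          (√(k * T * Real.log T) + k * L) := by
  have hm : 0 < m := by
    have : (0 : ℝ) < m := lt_of_lt_of_le (by positivity) hm₁
    exact_mod_cast this
  have hm' : (1 : ℝ) ≤ m := by exact_mod_cast hm
  have hlog := Real.log_natCast_nonneg T
  have hk : (0 : ℝ) < k := by exact_mod_cast NeZero.pos k
  set A := 64 * (4 * (c₃ / c₁) + 1) with hA
  have hA0 : 0 ≤ A := by positivity
  have hσm : (σ : ℝ) ^ 2 / m ≤ c₃ / c₁ := by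
    rw [div_le_div_iff₀ (by positivity) hc₁]
    nlinarith
  set e : Fin k → ℝ := fun a =>
    (((sdpAE k M σ T).pulls ν T).expect (fun N => (N a : ℝ≥0∞))).toReal with he
  have he0 : ∀ a, 0 ≤ e a := fun a => ENNReal.toReal_nonneg
  have hpull : ∀ a, 0 < gap ν a → e a ≤ 3 * c₂ * L + A * Real.log T / gap ν a ^ 2 := by
    intro a ha
    have hb := aePullBound_nonneg m σ T ν a
    have h := ENNReal.toReal_mono ENNReal.ofReal_ne_top
      (expect_sdpAE_pulls_le hm M σ hM T ν a ha)
    rw [ENNReal.toReal_ofReal (by positivity)] at h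
    have h2 : aePullBound m σ T ν a ≤ A * Real.log T / gap ν a ^ 2 := by
      rw [aePullBound, hA, mul_div_assoc 4 ((σ : ℝ) ^ 2)]
      gcongr
    -- Here m + 2 ≤ 3m, since m ≥ 1.
    linarith
  have hreg : regret (sdpAE k M σ T) ν T = ∑ a with 0 < gap ν a, e a * gap ν a := by
    rw [regret_eq_sum, Finset.sum_filter_of_ne]
    intro a _ hne
    exact lt_of_le_of_ne (gap_nonneg ν a) fun h => hne (by rw [← h, mul_zero])
  rw [hreg]
  constructor
  · rw [Finset.mul_sum]
    refine Finset.sum_le_sum fun a ha => ?_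
    have hg : 0 < gap ν a := (Finset.mem_filter.1 ha).2
    calc e a * gap ν a ≤ (3 * c₂ * L + A * Real.log T / gap ν a ^ 2) * gap ν a :=
          mul_le_mul_of_nonneg_right (hpull a hg) hg.le
      _ = A * (Real.log T / gap ν a) + 3 * c₂ * (gap ν a * L) := by field_simp; ring
      _ ≤ _ := by
          have h1 : 0 ≤ Real.log T / gap ν a := by positivity
          have h2 : 0 ≤ gap ν a * L := by positivity
          have h3 := mul_nonneg hA0 h2
          have h4 := mul_nonneg hc₂.le h1
          nlinarith
  · rcases Nat.eq_zero_or_pos T with rfl | hT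
    · have hsum := sum_expect_pulls_le (sdpAE k M σ 0) ν 0
      have hz : ∀ a, e a = 0 := fun a => le_antisymm
        ((Finset.single_le_sum (fun b _ => he0 b) (Finset.mem_univ a)).trans
          (by simpa using hsum)) (he0 a)
      simp only [hz, zero_mul, Finset.sum_const_zero]
      positivity
    have hT' : (0 : ℝ) < T := by exact_mod_cast hT
    have hsum : ∑ a, e a ≤ T := sum_expect_pulls_le (sdpAE k M σ T) ν T
    set w := √((k : ℝ) * T * Real.log T) with hw
    have hw0 : 0 ≤ w := Real.sqrt_nonneg _
    calc ∑ a with 0 < gap ν a, e a * gap ν a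
        ≤ ∑ a with 0 < gap ν a, (e a / T * w + (3 * c₂ * L + A * (w / k))) := by
          refine Finset.sum_le_sum fun a ha => ?_
          have hg : 0 < gap ν a := (Finset.mem_filter.1 ha).2
          exact mul_gap_le_of_pulls_le hg (he0 a) (by positivity) hA0 hlog hk hT'
            (gap_le_one ν a) (hpull a hg)
      _ ≤ ∑ a, (e a / T * w + (3 * c₂ * L + A * (w / k))) := by
          refine Finset.sum_le_sum_of_subset_of_nonneg (Finset.filter_subset _ _) fun a _ _ => ?_
          have := he0 a
          positivity
      _ = (∑ a, e a) / T * w + (3 * c₂ * (k * L) + A * w) := by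
          rw [Finset.sum_add_distrib, ← Finset.sum_mul, ← Finset.sum_div]
          simp
          field_simp
      _ ≤ 1 * w + (3 * c₂ * (k * L) + A * w) := by
          gcongr
          exact (div_le_one hT').2 hsum
      _ ≤ _ := by
          have h2 : 0 ≤ k * L := by positivity
          have h3 := mul_nonneg hA0 h2
          have h4 := mul_nonneg hc₂.le hw0
          nlinarith

theorem sdpAE_bounds {c₁ c₂ c₃ : ℝ} (hc₁ : 0 < c₁) (hc₂ : 0 < c₂) (hc₃ : 0 < c₃) :
    ∃ C : ℝ, 0 < C ∧
      ∀ ε δ : ℝ, 0 < ε → ε < 1 → 0 < δ → δ < 1 →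
      ∀ m : ℕ, c₁ * (Real.log (1 / δ) / ε ^ 2) ≤ m → m ≤ c₂ * (Real.log (1 / δ) / ε ^ 2) →
      ∀ σ : ℝ≥0, (σ : ℝ) ^ 2 ≤ c₃ * (Real.log (1 / δ) / ε ^ 2) →
      ∀ (Y : Type*) (M : ShuffleMechanism m Y), M.IsPrivateBinarySum ε δ σ →
      ∀ (k : ℕ) [NeZero k] (T : ℕ),
        (sdpAE k M σ T).IsSDP ε δ ∧
        ∀ ν : Fin k → PMF Bool,
          regret (sdpAE k M σ T) ν T
            ≤ C * ∑ a with 0 < gap ν a,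
                (Real.log T / gap ν a + gap ν a * Real.log (1 / δ) / ε ^ 2) ∧
          regret (sdpAE k M σ T) ν T
            ≤ C * ((∑ a with 0 < gap ν a, Real.log T / gap ν a)
                + k * Real.log (1 / δ) / ε ^ 2) ∧
          regret (sdpAE k M σ T) ν T
            ≤ C * (√(k * T * Real.log T) + k * Real.log (1 / δ) / ε ^ 2) := by
  refine ⟨3 * c₂ + (64 * (4 * (c₃ / c₁) + 1) + 1), by positivity, ?_⟩
  intro ε δ hε _ hδ hδ1 m hm₁ hm₂ σ hσ Y M hM k _ T
  refine ⟨fun _ => hM.1, fun ν => ?_⟩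
  have hL : 0 < Real.log (1 / δ) / ε ^ 2 :=
    div_pos (Real.log_pos ((one_lt_div hδ).2 hδ1)) (by positivity)
  obtain ⟨h1, h3⟩ := sdpAE_regret_le hc₁ hc₂ hc₃ hL hm₁ hm₂ hσ M hM.2 k T ν
  simp only [mul_div_assoc]
  refine ⟨h1, h1.trans (mul_le_mul_of_nonneg_left ?_ (by positivity)), h3⟩
  rw [Finset.sum_add_distrib]
  gcongr
  calc ∑ a with 0 < gap ν a, gap ν a * (Real.log (1 / δ) / ε ^ 2)
      ≤ ∑ _a : Fin k, Real.log (1 / δ) / ε ^ 2 := by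
        refine (Finset.sum_le_sum fun a _ => ?_).trans
          (Finset.sum_le_sum_of_subset_of_nonneg (Finset.filter_subset _ _) fun _ _ _ => hL.le)
        exact mul_le_of_le_one_left hL.le (gap_le_one ν a)
    _ = k * (Real.log (1 / δ) / ε ^ 2) := by simp

/-! ### The number of ones among independent biased bits -/

/-- The law of the number of successes in `n` independent trials with success probability `p`. -/
noncomputable def successCount (p : ℝ) : ℕ → PMF ℕ
  | 0 => PMF.pure 0
  | n + 1 => (coin p).bind fun b => (successCount p n).map fun c => (if b then 1 else 0) + c

theorem successCount_one (p : ℝ) :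
    successCount p 1 = (coin p).map fun b => if b then 1 else 0 := by
  simp only [successCount, PMF.pure_map, add_zero]
  rw [← PMF.bind_pure_comp]
  rfl

theorem successCount_add (p : ℝ) (b : ℕ) : ∀ a : ℕ,
    ((successCount p a).bind fun x => (successCount p b).map fun y => x + y)
      = successCount p (a + b)
  | 0 => by
    simp only [successCount, PMF.pure_bind, zero_add]
    exact PMF.map_id _
  | a + 1 => by
    rw [Nat.add_right_comm, successCount, successCount, PMF.bind_bind]
    congr 1
    funext t
    rw [← successCount_add p b a, PMF.map_bind, PMF.bind_map]
    congr 1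
    funext x
    rw [PMF.map_comp]
    simp only [Function.comp_def, add_assoc]

theorem indep_map_sum {α : Type*} {p : ℝ} {q : ℕ} {P : PMF α} {f : α → ℕ}
    (h : P.map f = successCount p q) : ∀ n : ℕ,
    ((indep fun _ : Fin n => P).map fun y => ∑ i, f (y i)) = successCount p (n * q)
  | 0 => by simp [indep, PMF.pure_map, successCount]
  | n + 1 => by
    rw [indep, PMF.map_bind, Nat.succ_mul, Nat.add_comm (n * q), ← successCount_add, ← h,
      PMF.bind_map]
    congr 1
    funext a
    rw [← indep_map_sum h n, PMF.map_comp]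
    simp only [Function.comp_def, Fin.sum_univ_succ, Fin.cons_zero, Fin.cons_succ, PMF.map_comp]

theorem indep_map {α β : Type*} : ∀ {n : ℕ} (P : Fin n → PMF α) (f : Fin n → α → β),
    (indep fun i => (P i).map (f i)) = (indep P).map fun y i => f i (y i)
  | 0, P, f => by
    rw [indep, indep, PMF.pure_map]
    congr 1
    funext i; exact i.elim0
  | n + 1, P, f => by
    rw [indep, indep, indep_map (fun i => P i.succ) (fun i => f i.succ), PMF.map_bind,
      PMF.bind_map]
    congr 1
    funext a
    rw [Function.comp_apply, PMF.map_comp, PMF.map_comp]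
    congr 1
    funext y i
    refine Fin.cases ?_ (fun j => ?_) i <;> simp


/-! ### Moments and tails of the binomial law -/

theorem coin_true {p : ℝ} (hp0 : 0 ≤ p) (hp1 : p ≤ 1) : coin p true = ENNReal.ofReal p := by
  simp [coin, hp0, hp1]

theorem coin_false {p : ℝ} (hp0 : 0 ≤ p) (hp1 : p ≤ 1) :
    coin p false = ENNReal.ofReal (1 - p) := by
  simp [coin, hp0, hp1]

theorem expect_coin {p : ℝ} (hp0 : 0 ≤ p) (hp1 : p ≤ 1) (f : Bool → ℝ≥0∞) :
    (coin p).expect f = ENNReal.ofReal p * f true + ENNReal.ofReal (1 - p) * f false := by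
  rw [PMF.expect, tsum_fintype, Fintype.sum_bool, coin_true hp0 hp1, coin_false hp0 hp1]

theorem expect_exp_successCount (p t : ℝ) : ∀ n : ℕ,
    (successCount p n).expect (fun c => ENNReal.ofReal (Real.exp (t * (c - n * p))))
      = (coin p).expect (fun b => ENNReal.ofReal (Real.exp (t * ((if b then 1 else 0) - p)))) ^ n
  | 0 => by simp [successCount, PMF.expect_pure]
  | n + 1 => by
    rw [successCount, PMF.expect_bind, pow_succ', ← expect_exp_successCount p t n,
      ← PMF.expect_mul_const]
    congr 1
    funext b
    rw [PMF.expect_map, ← PMF.expect_const_mul]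
    congr 1
    funext c
    rw [← ENNReal.ofReal_mul (Real.exp_pos _).le, ← Real.exp_add]
    congr 2
    cases b <;> push_cast <;> simp <;> ring

theorem expect_successCount {p : ℝ} (hp0 : 0 ≤ p) (hp1 : p ≤ 1) : ∀ n : ℕ,
    (successCount p n).expect (fun c => (c : ℝ≥0∞)) = ENNReal.ofReal (n * p)
  | 0 => by simp [successCount, PMF.expect_pure]
  | n + 1 => by
    rw [successCount, PMF.expect_bind]
    simp only [PMF.expect_map, Nat.cast_add, PMF.expect_add, PMF.expect_const,
      expect_successCount hp0 hp1 n]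
    rw [expect_coin hp0 hp1, Nat.cast_one, add_mul, one_mul, add_comm,
      ENNReal.ofReal_add (by positivity) hp0]
    simp [add_comm]

theorem expect_exp_successCount_le {p : ℝ} (hp0 : 0 ≤ p) (hp1 : p ≤ 1) (t : ℝ) (n : ℕ) :
    (successCount p n).expect (fun c => ENNReal.ofReal (Real.exp (t * (c - n * p))))
      ≤ ENNReal.ofReal (Real.exp (n * t ^ 2 / 8)) := by
  have h := expect_exp_bit_le (coin p) t
  rw [coin_true hp0 hp1, ENNReal.toReal_ofReal hp0] at h
  rw [expect_exp_successCount]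
  refine (pow_le_pow_left' h n).trans (le_of_eq ?_)
  rw [← ENNReal.ofReal_pow (Real.exp_pos _).le, ← Real.exp_nat_mul, mul_div_assoc]

/-- For |t| ≤ 1, e^t ≤ 1 + t + t². Unlike Hoeffding's n/4, the proxy is of order np; the privacy
proof needs this when the bias τ/(2m) is small. -/
theorem expect_exp_successCount_le_of_abs_le_one {p : ℝ} (hp0 : 0 ≤ p) (hp1 : p ≤ 1) {t : ℝ}
    (ht : |t| ≤ 1) (n : ℕ) :
    (successCount p n).expect (fun c => ENNReal.ofReal (Real.exp (t * (c - n * p))))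
      ≤ ENNReal.ofReal (Real.exp (n * p * t ^ 2)) := by
  have h : (coin p).expect
      (fun b => ENNReal.ofReal (Real.exp (t * ((if b then 1 else 0) - p))))
      ≤ ENNReal.ofReal (Real.exp (p * t ^ 2)) := by
    rw [expect_coin hp0 hp1, ← ENNReal.ofReal_mul hp0, ← ENNReal.ofReal_mul (by linarith),
      ← ENNReal.ofReal_add (mul_nonneg hp0 (Real.exp_pos _).le)
        (mul_nonneg (by linarith) (Real.exp_pos _).le)]
    refine ENNReal.ofReal_le_ofReal ?_
    simp only [if_true, Bool.false_eq_true, if_false]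
    have h1 := (abs_le.1 (Real.abs_exp_sub_one_sub_id_le ht)).2
    calc p * Real.exp (t * (1 - p)) + (1 - p) * Real.exp (t * (0 - p))
        = Real.exp (-(t * p)) * (p * (Real.exp t - 1) + 1) := by
          rw [show t * (1 - p) = -(t * p) + t by ring, Real.exp_add,
            show t * (0 - p) = -(t * p) by ring]
          ring
      _ ≤ Real.exp (-(t * p)) * Real.exp (p * (t + t ^ 2)) := by
          refine mul_le_mul_of_nonneg_left ?_ (Real.exp_pos _).le
          refine le_trans ?_ (Real.add_one_le_exp _)
          nlinarith
      _ = Real.exp (p * t ^ 2) := by rw [← Real.exp_add]; congr 1; ring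
  rw [expect_exp_successCount]
  refine (pow_le_pow_left' h n).trans (le_of_eq ?_)
  rw [← ENNReal.ofReal_pow (Real.exp_pos _).le, ← Real.exp_nat_mul, mul_assoc]

/-- Chernoff bound; the sign of `t` selects the tail. -/
theorem successCount_tail_le {p : ℝ} (hp0 : 0 ≤ p) (hp1 : p ≤ 1) {t : ℝ} (ht : |t| ≤ 1) (n : ℕ)
    (B : Set ℕ) (hB : ∀ c ∈ B, 2 * t ^ 2 * (n * p) ≤ t * (c - n * p)) :
    (successCount p n).toOuterMeasure B ≤ ENNReal.ofReal (Real.exp (-(n * p * t ^ 2))) := by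
  rw [PMF.toOuterMeasure_eq_expect]
  have h : ∀ c, B.indicator (1 : ℕ → ℝ≥0∞) c ≤ ENNReal.ofReal (Real.exp (-(2 * t ^ 2 * (n * p)))) *
      ENNReal.ofReal (Real.exp (t * (c - n * p))) := by
    intro c
    by_cases hc : c ∈ B
    · rw [Set.indicator_of_mem hc, ← ENNReal.ofReal_mul (Real.exp_pos _).le, ← Real.exp_add,
        Pi.one_apply, ENNReal.one_le_ofReal, Real.one_le_exp_iff]
      linarith [hB c hc]
    · rw [Set.indicator_of_notMem hc]; exact zero_le
  refine (PMF.expect_mono _ h).trans ?_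
  rw [PMF.expect_const_mul]
  refine (mul_le_mul_right (expect_exp_successCount_le_of_abs_le_one hp0 hp1 ht n) _).trans
    (le_of_eq ?_)
  rw [← ENNReal.ofReal_mul (Real.exp_pos _).le, ← Real.exp_add]
  congr 2
  ring

/-! ### Point probabilities of the binomial law -/

theorem map_add_apply (P : PMF ℕ) (d c : ℕ) : (P.map fun x => d + x) (d + c) = P c := by
  rw [PMF.map_apply, tsum_eq_single c]
  · simp
  · intro b hb
    simp [hb.symm]

theorem map_one_add_apply_zero (P : PMF ℕ) : (P.map fun x => 1 + x) 0 = 0 := by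
  rw [PMF.map_apply]
  simp
  omega

theorem successCount_apply {p : ℝ} (hp0 : 0 ≤ p) (hp1 : p ≤ 1) : ∀ n c : ℕ,
    successCount p n c = ENNReal.ofReal (n.choose c * p ^ c * (1 - p) ^ (n - c))
  | 0, 0 => by simp [successCount]
  | 0, c + 1 => by simp [successCount]
  | n + 1, c => by
    have hq : 0 ≤ 1 - p := by linarith
    rw [successCount, PMF.bind_apply, tsum_fintype, Fintype.sum_bool, coin_true hp0 hp1,
      coin_false hp0 hp1]
    simp only [if_true, Bool.false_eq_true, if_false, zero_add]
    rw [show (fun c : ℕ => c) = id from rfl, PMF.map_id]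
    cases c with
    | zero =>
      rw [map_one_add_apply_zero, successCount_apply hp0 hp1 n 0, mul_zero, zero_add,
        ← ENNReal.ofReal_mul hq]
      simp [pow_succ']
    | succ c =>
      rw [Nat.add_comm c 1, map_add_apply, successCount_apply hp0 hp1 n c,
        successCount_apply hp0 hp1 n (1 + c), ← ENNReal.ofReal_mul hp0, ← ENNReal.ofReal_mul hq,
        ← ENNReal.ofReal_add (by positivity) (by positivity)]
      congr 1
      rw [Nat.add_comm 1 c, Nat.choose_succ_succ, Nat.succ_sub_succ]
      push_cast
      -- For c ≥ n the exponent n − (c + 1) is truncated to 0, but its binomial coefficient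
      -- vanishes.
      rcases lt_or_ge c n with h | h
      · rw [show n - c = (n - (c + 1)) + 1 by omega]
        ring
      · rw [Nat.choose_eq_zero_of_lt (Nat.lt_succ_of_le h)]
        simp
        ring

/-- The ratio of consecutive binomial probabilities. -/
theorem successCount_succ_mul {p : ℝ} (hp0 : 0 ≤ p) (hp1 : p ≤ 1) (n c : ℕ) :
    (successCount p n (c + 1)).toReal * ((c + 1) * (1 - p))
      = (successCount p n c).toReal * ((n - c) * p) := by
  have hq : 0 ≤ 1 - p := by linarith
  rw [successCount_apply hp0 hp1, successCount_apply hp0 hp1,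
    ENNReal.toReal_ofReal (by positivity), ENNReal.toReal_ofReal (by positivity)]
  have h := Nat.choose_succ_right_eq n c
  rcases lt_trichotomy c n with hc | hc | hc
  · have h' : (n.choose (c + 1) : ℝ) * (c + 1) = n.choose c * (n - c) := by
      rw [← Nat.cast_sub hc.le]; exact_mod_cast h
    rw [show n - c = (n - (c + 1)) + 1 by omega]
    calc _ = ((n.choose (c + 1) : ℝ) * (c + 1)) * (p ^ (c + 1) * (1 - p) ^ (n - (c + 1))
          * (1 - p)) := by ring
      _ = _ := by rw [h']; ring
  · subst hc
    simp
  · rw [Nat.choose_eq_zero_of_lt hc, Nat.choose_eq_zero_of_lt (by omega)]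
    simp

/-! ### Privacy of a noisy count -/

theorem PMF.expect_le_mul_expect_add {α : Type*} (P Q : PMF α) (K d : ℝ≥0∞) (bad : Set α)
    (h : ∀ c ∉ bad, P c ≤ K * Q c) (hbad : P.toOuterMeasure bad ≤ d) (f : α → ℝ≥0∞)
    (hf : ∀ c, f c ≤ 1) : P.expect f ≤ K * Q.expect f + d := by
  refine le_trans ?_ (add_le_add_right hbad _)
  rw [PMF.toOuterMeasure_eq_expect]
  unfold PMF.expect
  rw [← ENNReal.tsum_mul_left, ← ENNReal.tsum_add]
  refine ENNReal.tsum_le_tsum fun c => ?_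
  by_cases hc : c ∈ bad
  · rw [Set.indicator_of_mem hc, Pi.one_apply]
    exact (mul_le_mul_right (hf c) _).trans le_add_self
  · rw [← mul_assoc]
    exact (mul_le_mul_left (h c hc) _).trans le_self_add

section SuccessCountPrivacy

variable {ε δ p : ℝ} {n : ℕ}

/-- The tail beyond relative deviation 0.3ε uses |t| = 0.15ε, and 48 · 0.15² = 1.08 ≥ 1. -/
theorem exp_neg_le_of_noise_le (hδ : 0 < δ) (hε : 0 < ε)
    (hn : 48 * Real.log (2 / δ) / ε ^ 2 ≤ n * p) (h1 : δ < 1) {t : ℝ} (ht : t ^ 2 = (0.15 * ε) ^ 2) :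
    Real.exp (-(n * p * t ^ 2)) ≤ δ := by
  rw [div_le_iff₀ (by positivity)] at hn
  have h2 : Real.log (1 / δ) ≤ Real.log (2 / δ) := by
    apply Real.log_le_log (by positivity); gcongr; norm_num
  have h3 : 0 ≤ Real.log (1 / δ) := (Real.log_pos ((one_lt_div hδ).2 h1)).le
  rw [← Real.le_log_iff_exp_le hδ, ht]
  rw [one_div, Real.log_inv] at h2 h3
  nlinarith

/-- Provides the slack 0.05 ε n p ≥ 3/2 that absorbs the off-by-one terms in the ratio bounds. -/
theorem noise_mean_large (hδ : 0 < δ) (hε : 0 < ε) (hε1 : ε < 1)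
    (hn : 48 * Real.log (2 / δ) / ε ^ 2 ≤ n * p) (h1 : δ < 1) : 30 ≤ ε * (n * p) := by
  rw [div_le_iff₀ (by positivity)] at hn
  have h2 : Real.log 2 ≤ Real.log (2 / δ) :=
    Real.log_le_log (by norm_num) (by rw [le_div_iff₀ hδ]; nlinarith)
  have h3 := Real.log_two_gt_d9
  by_contra! h
  nlinarith

/-- Only the lower tail is bad: P(c + 1)/P(c) decreases in c, and the shifted law has no mass at 0.
The bias p ≤ 1/2 turns ε(1 − p) into at least ε/2. -/
theorem successCount_private_left (hp0 : 0 < p) (hp : p ≤ 1 / 2) (hδ : 0 < δ) (hε : 0 < ε)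
    (hε1 : ε < 1) (h1 : δ < 1) (hn : 48 * Real.log (2 / δ) / ε ^ 2 ≤ n * p) (f : ℕ → ℝ≥0∞)
    (hf : ∀ c, f c ≤ 1) :
    (successCount p n).expect f
      ≤ ENNReal.ofReal (Real.exp ε) * (successCount p n).expect (fun c => f (1 + c))
        + ENNReal.ofReal δ := by
  have hp1 : p ≤ 1 := by linarith
  have hbig := noise_mean_large hδ hε hε1 hn h1
  have hexp := Real.add_one_le_exp ε
  rw [← PMF.expect_map _ (fun c => 1 + c) f]
  refine PMF.expect_le_mul_expect_add _ _ _ _ {c : ℕ | (c : ℝ) ≤ n * p * (1 - 0.3 * ε)} ?_ ?_ f hf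
  · intro c hc
    rw [Set.mem_ofPred_eq, not_le] at hc
    cases c with
    | zero =>
      rw [Nat.cast_zero] at hc
      nlinarith
    | succ c =>
      rw [Nat.add_comm c 1, map_add_apply, Nat.add_comm 1 c,
        ← ENNReal.ofReal_toReal ((successCount p n).apply_ne_top (c + 1)),
        ← ENNReal.ofReal_toReal ((successCount p n).apply_ne_top c),
        ← ENNReal.ofReal_mul (Real.exp_pos _).le]
      refine ENNReal.ofReal_le_ofReal ?_
      have hr := successCount_succ_mul hp0.le hp1 n c
      have h0 : 0 ≤ (successCount p n c).toReal := ENNReal.toReal_nonneg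
      have hpos : 0 < ((c : ℝ) + 1) * (1 - p) := mul_pos (by positivity) (by linarith)
      rw [← mul_le_mul_iff_left₀ hpos, hr, mul_right_comm, mul_comm _ (successCount p n c).toReal]
      refine mul_le_mul_of_nonneg_left ?_ h0
      push_cast at hc
      -- Since (1 − 0.3ε)(1 + ε/2) ≥ 1 + 0.05ε; the summand 1/2 later pays for p.
      have h2 : ((c : ℝ) + 1) * (1 + ε / 2) ≥ n * p + 1 / 2 := by
        have : n * p * (1 - 0.3 * ε) * (1 + ε / 2) ≤ ((c : ℝ) + 1) * (1 + ε / 2) := by gcongr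
        nlinarith
      have h3 : 0 ≤ ((c : ℝ) + 1) * ε * (1 / 2 - p) :=
        mul_nonneg (by positivity) (by linarith)
      have h4 : (1 + ε) * (((c : ℝ) + 1) * (1 - p)) ≤ Real.exp ε * (((c : ℝ) + 1) * (1 - p)) :=
        mul_le_mul_of_nonneg_right (by linarith) hpos.le
      nlinarith
  · refine (successCount_tail_le hp0.le hp1 (t := -(0.15 * ε)) ?_ n _ ?_).trans
      (ENNReal.ofReal_le_ofReal (exp_neg_le_of_noise_le hδ hε hn h1 (by ring)))
    · rw [abs_neg, abs_of_pos (by positivity)]; linarith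
    · intro c hc
      rw [Set.mem_ofPred_eq] at hc
      nlinarith

theorem successCount_private_right (hp0 : 0 < p) (hp : p ≤ 1 / 2) (hδ : 0 < δ) (hε : 0 < ε)
    (hε1 : ε < 1) (h1 : δ < 1) (hn : 48 * Real.log (2 / δ) / ε ^ 2 ≤ n * p) (f : ℕ → ℝ≥0∞)
    (hf : ∀ c, f c ≤ 1) :
    (successCount p n).expect (fun c => f (1 + c))
      ≤ ENNReal.ofReal (Real.exp ε) * (successCount p n).expect f + ENNReal.ofReal δ := by
  have hp1 : p ≤ 1 := by linarith
  have hbig := noise_mean_large hδ hε hε1 hn h1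
  have hexp := Real.add_one_le_exp ε
  rw [← PMF.expect_map _ (fun c => 1 + c) f]
  refine PMF.expect_le_mul_expect_add _ _ _ _
    -- For the opposite ratio the upper tail is bad; it is shifted because the law on the left
    -- counts 1 + c.
    ((fun c => 1 + c) '' {c : ℕ | n * p * (1 + 0.3 * ε) ≤ (c : ℝ)}) ?_ ?_ f hf
  · intro c hc
    cases c with
    | zero => rw [map_one_add_apply_zero]; exact zero_le
    | succ c =>
      have hc' : (c : ℝ) < n * p * (1 + 0.3 * ε) := not_le.1 fun h =>
        hc ⟨c, h, Nat.add_comm 1 c⟩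
      rw [Nat.add_comm c 1, map_add_apply, Nat.add_comm 1 c,
        ← ENNReal.ofReal_toReal ((successCount p n).apply_ne_top (c + 1)),
        ← ENNReal.ofReal_toReal ((successCount p n).apply_ne_top c),
        ← ENNReal.ofReal_mul (Real.exp_pos _).le]
      refine ENNReal.ofReal_le_ofReal ?_
      have hr := successCount_succ_mul hp0.le hp1 n c
      have h0 : 0 ≤ (successCount p n c).toReal := ENNReal.toReal_nonneg
      have hpos : 0 < ((c : ℝ) + 1) * (1 - p) := mul_pos (by positivity) (by linarith)
      rw [← mul_le_mul_iff_left₀ hpos, mul_assoc (Real.exp ε), hr,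
        mul_left_comm (Real.exp ε)]
      refine mul_le_mul_of_nonneg_left ?_ h0
      have h2 : (c : ℝ) * (1 + ε / 2) + 1 ≤ (1 + ε) * (n * p) := by
        have : (c : ℝ) * (1 + ε / 2) ≤ n * p * (1 + 0.3 * ε) * (1 + ε / 2) := by gcongr
        nlinarith
      have h3 : 0 ≤ (c : ℝ) * ε * (1 / 2 - p) := mul_nonneg (by positivity) (by linarith)
      have h5 : ((c : ℝ) + 1) * (1 - p) ≤ (1 + ε) * ((n - c) * p) := by nlinarith
      have h6 : 0 ≤ ((n : ℝ) - c) * p := by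
        by_contra! h
        nlinarith
      exact h5.trans (mul_le_mul_of_nonneg_right (by linarith) h6)
  · rw [PMF.toOuterMeasure_map_apply, Set.preimage_image_eq _ (add_right_injective 1)]
    refine (successCount_tail_le hp0.le hp1 (t := 0.15 * ε) ?_ n _ ?_).trans
      (ENNReal.ofReal_le_ofReal (exp_neg_le_of_noise_le hδ hε hn h1 rfl))
    · rw [abs_of_pos (by positivity)]; linarith
    · intro c hc
      rw [Set.mem_ofPred_eq] at hc
      nlinarith

end SuccessCountPrivacy

/-! ### Shuffling bits -/

/-- Positions carrying the same value are equinumerous in both lists, so bijections of the fibres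
can be glued. -/
theorem exists_equiv_of_perm {α : Type*} {l l' : List α} (h : l.Perm l') :
    ∃ e : Fin l.length ≃ Fin l'.length, ∀ i, l'.get (e i) = l.get i := by
  classical
  have hcard : ∀ l : List α, ∀ c, Fintype.card {i : Fin l.length // l.get i = c} = l.count c := by
    intro l c
    have := Fin.univ_val_map l.get
    rw [List.ofFn_get] at this
    rw [Fintype.card_subtype, ← Multiset.coe_count, ← this, Multiset.count_map]
    simp only [eq_comm]
    rfl
  have e : ∀ c, {i : Fin l.length // l.get i = c} ≃ {i : Fin l'.length // l'.get i = c} := fun c =>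
    Fintype.equivOfCardEq (by rw [hcard, hcard, h.count_eq])
  exact ⟨Equiv.ofFiberEquiv e, Equiv.ofFiberEquiv_map e⟩

theorem PMF.map_uniformOfFintype_equiv {α β : Type*} [Fintype α] [Fintype β] [Nonempty α]
    [Nonempty β] (e : α ≃ β) :
    (PMF.uniformOfFintype α).map e = PMF.uniformOfFintype β := by
  ext b
  rw [PMF.map_apply, tsum_eq_single (e.symm b)]
  · simp [Fintype.card_congr e]
  · intro a ha
    rw [if_neg]
    rintro rfl
    simp at ha

/-- The output of the shuffler depends only on the multiset of messages. -/
theorem shuffle_eq_of_perm {Y : Type*} {l l' : List Y} (h : l.Perm l') : shuffle l = shuffle l' := by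
  obtain ⟨e, he⟩ := exists_equiv_of_perm h
  have hlen := h.length_eq
  -- Relabelling the positions of the messages by `e` is a bijection of permutations and so
  -- preserves the uniform law.
  rw [shuffle, shuffle, ← PMF.map_uniformOfFintype_equiv (Equiv.equivCongr (finCongr hlen) e),
    PMF.map_comp]
  congr 1
  funext s
  refine List.ext_get (by simpa using hlen) fun i h1 h2 => ?_
  simp only [Function.comp_apply, List.get_ofFn, Equiv.equivCongr_apply_apply, he]
  rfl

theorem shuffle_map_eq_pure {Y Z : Type*} (l : List Y) (f : List Y → Z)
    (hf : ∀ l', l'.Perm l → f l' = f l) : (shuffle l).map f = PMF.pure (f l) := by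
  rw [shuffle, PMF.map_comp]
  have : (f ∘ fun s : Equiv.Perm (Fin l.length) => List.ofFn fun i => l.get (s i))
      = fun _ => f l := by
    funext s
    refine hf _ ?_
    have := Equiv.Perm.ofFn_comp_perm s l.get
    rwa [List.ofFn_get] at this
  rw [this]
  exact PMF.map_const _ _

/-! ### Binary summation with binomial noise -/

/-- Every user sends its bit and `q` noise bits with bias `p`; the analyzer counts the ones and
subtracts the expected number of noise ones. -/
noncomputable def noisyBitSum (p : ℝ) (q m : ℕ) : ShuffleMechanism m Bool where
  encode x := (indep fun _ : Fin q => coin p).map fun y => x :: List.ofFn y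
  analyze z := (z.count true : ℝ) - (m * q : ℕ) * p

def bitSum {m : ℕ} (x : Fin m → Bool) : ℕ := ∑ i, if x i then 1 else 0

theorem count_true_ofFn {n : ℕ} (y : Fin n → Bool) :
    (List.ofFn y).count true = bitSum y := by
  unfold bitSum
  induction n with
  | zero => simp
  | succ n ih =>
    rw [List.ofFn_succ, List.count_cons, ih, Fin.sum_univ_succ, add_comm]
    simp

theorem count_flatten_ofFn {m : ℕ} (f : Fin m → List Bool) :
    (List.ofFn f).flatten.count true = ∑ i, (f i).count true := by
  rw [List.count_flatten, List.map_ofFn, List.sum_ofFn]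
  rfl

theorem length_flatten_ofFn {m : ℕ} (f : Fin m → List Bool) :
    (List.ofFn f).flatten.length = ∑ i, (f i).length := by
  rw [List.length_flatten, List.map_ofFn, List.sum_ofFn]
  rfl

theorem perm_of_count_true {l l' : List Bool} (hc : l.count true = l'.count true)
    (hl : l.length = l'.length) : l.Perm l' := by
  refine List.perm_iff_count.2 fun b => ?_
  cases b with
  | true => exact hc
  | false =>
    have h1 := List.count_true_add_count_false l
    have h2 := List.count_true_add_count_false l'
    omega

theorem coins_map_sum (p : ℝ) (q : ℕ) :
    ((indep fun _ : Fin q => coin p).map bitSum) = successCount p q := by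
  have := indep_map_sum (successCount_one p).symm q
  rwa [mul_one] at this

/-- The shuffler's output only reveals the noisy number of ones. -/
theorem noisyBitSum_shuffled (p : ℝ) (q m : ℕ) (x : Fin m → Bool) :
    (noisyBitSum p q m).shuffled x = (successCount p (m * q)).bind fun c =>
      shuffle (List.replicate (bitSum x + c) true ++
        List.replicate (m * (1 + q) - (bitSum x + c)) false) := by
  rw [ShuffleMechanism.shuffled, ← indep_map_sum (coins_map_sum p q) m, PMF.bind_map]
  simp only [noisyBitSum]
  rw [indep_map, PMF.bind_map]
  congr 1
  funext y
  refine shuffle_eq_of_perm ?_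
  have hc : (List.ofFn fun i => x i :: List.ofFn (y i)).flatten.count true
      = bitSum x + ∑ i, bitSum (y i) := by
    rw [count_flatten_ofFn, bitSum, ← Finset.sum_add_distrib]
    refine Finset.sum_congr rfl fun i _ => ?_
    rw [List.count_cons, count_true_ofFn, add_comm]
    simp
  have hl : (List.ofFn fun i => x i :: List.ofFn (y i)).flatten.length = m * (1 + q) := by
    rw [length_flatten_ofFn]
    simp [add_comm]
  have hle := List.count_le_length (a := true)
    (l := (List.ofFn fun i => x i :: List.ofFn (y i)).flatten)
  rw [hc, hl] at hle
  beta_reduce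
  refine perm_of_count_true ?_ ?_
  · rw [hc]
    simp [List.count_replicate]
  · rw [hl]
    simp only [List.length_append, List.length_replicate]
    omega

theorem noisyBitSum_output (p : ℝ) (q m : ℕ) (x : Fin m → Bool) :
    (noisyBitSum p q m).output x
      = ((successCount p (m * q)).map fun c : ℕ => (c : ℝ) - (m * q : ℕ) * p).map
          fun e => (∑ i, if x i then (1 : ℝ) else 0) + e := by
  rw [ShuffleMechanism.output, noisyBitSum_shuffled, PMF.map_bind, PMF.map_comp,
    ← PMF.bind_pure_comp]
  congr 1
  funext c
  rw [shuffle_map_eq_pure]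
  · refine congrArg PMF.pure ?_
    simp [noisyBitSum, List.count_replicate, bitSum]
    ring
  · intro l' hl'
    simp only [noisyBitSum, hl'.count_eq]

theorem bitSum_cases {m : ℕ} {x x' : Fin m → Bool} (h : hammingDist x x' ≤ 1) :
    bitSum x = bitSum x' ∨ bitSum x = 1 + bitSum x' ∨ bitSum x' = 1 + bitSum x := by
  have key : ∀ u v : Fin m → Bool, bitSum u ≤ bitSum v + hammingDist u v := by
    intro u v
    rw [hammingDist, Finset.card_filter, bitSum, bitSum, ← Finset.sum_add_distrib]
    refine Finset.sum_le_sum fun i _ => ?_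
    cases u i <;> cases v i <;> simp
  have h1 := key x x'
  have h2 := key x' x
  rw [hammingDist_comm] at h2
  omega

/-- Post-processing: given the number of ones, the shuffler hits `B` with a probability `g`
independent of the input. It remains to compare binomial expectations of a [0, 1]-valued function
under a shift by at most one. -/
theorem noisyBitSum_isSDP {p ε δ : ℝ} {q m : ℕ} (hp0 : 0 < p) (hp : p ≤ 1 / 2) (hδ : 0 < δ)
    (hε : 0 < ε) (hε1 : ε < 1) (h1 : δ < 1)
    (hn : 48 * Real.log (2 / δ) / ε ^ 2 ≤ (m * q : ℕ) * p) :
    (noisyBitSum p q m).IsSDP ε δ := by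
  intro x x' hx B
  set g : ℕ → ℝ≥0∞ := fun c => (shuffle (List.replicate c true ++
        List.replicate (m * (1 + q) - c) false)).toOuterMeasure B with hg
  have hg1 : ∀ c, g c ≤ 1 := fun c => by
    simp only [hg, PMF.toOuterMeasure_eq_expect]
    refine (PMF.expect_mono _ fun l => ?_).trans (PMF.expect_const _ 1).le
    exact Set.indicator_le_self' (fun _ _ => zero_le) l
  simp only [noisyBitSum_shuffled, PMF.toOuterMeasure_bind_eq_expect]
  change (successCount p (m * q)).expect (fun c => g (bitSum x + c)) ≤ ENNReal.ofReal (Real.exp ε) *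
    (successCount p (m * q)).expect (fun c => g (bitSum x' + c)) + ENNReal.ofReal δ
  rcases bitSum_cases hx with h | h | h
  · rw [h]
    refine le_trans ?_ le_self_add
    refine le_mul_of_one_le_left zero_le ?_
    rw [ENNReal.one_le_ofReal]
    exact Real.one_le_exp hε.le
  · have := successCount_private_right hp0 hp hδ hε hε1 h1 hn (fun c => g (bitSum x' + c))
      fun c => hg1 _
    simpa only [h, add_assoc, add_left_comm] using this
  · have := successCount_private_left hp0 hp hδ hε hε1 h1 hn (fun c => g (bitSum x + c))
      fun c => hg1 _
    simpa only [h, add_assoc, add_left_comm] using this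

theorem noisyBitSum_hasSubgaussianError {p : ℝ} {q m : ℕ} (hp0 : 0 ≤ p) (hp1 : p ≤ 1) (σ : ℝ≥0)
    (hσ : ((m * q : ℕ) : ℝ) / 4 ≤ (σ : ℝ) ^ 2) :
    (noisyBitSum p q m).HasSubgaussianError σ := by
  refine ⟨(successCount p (m * q)).map fun c : ℕ => (c : ℝ) - (m * q : ℕ) * p,
    noisyBitSum_output p q m, ?_, ?_⟩
  · generalize m * q = n
    have hl : ∫⁻ c : ℕ, ENNReal.ofReal (c : ℝ) ∂(successCount p n).toMeasure
        = ENNReal.ofReal (n * p) := by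
      rw [PMF.lintegral_toMeasure _ Measurable.of_discrete, ← expect_successCount hp0 hp1]
      simp
    have hi : Integrable (fun c : ℕ => (c : ℝ)) (successCount p n).toMeasure := by
      refine ⟨Measurable.of_discrete.aestronglyMeasurable, ?_⟩
      rw [hasFiniteIntegral_iff_ofReal (Filter.Eventually.of_forall fun _ => Nat.cast_nonneg _),
        hl]
      exact ENNReal.ofReal_lt_top
    rw [← PMF.toMeasure_map (hf := Measurable.of_discrete),
      integral_map Measurable.of_discrete.aemeasurable (by fun_prop),
      integral_sub hi (integrable_const _), integral_eq_lintegral_of_nonneg_ae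
        (Filter.Eventually.of_forall fun _ => Nat.cast_nonneg _) hi.1, hl,
      ENNReal.toReal_ofReal (by positivity)]
    simp
  · refine hasSubgaussianMGF_of_expect_exp _ _ fun t => ?_
    rw [PMF.expect_map]
    refine (expect_exp_successCount_le hp0 hp1 t _).trans
      (ENNReal.ofReal_le_ofReal (Real.exp_le_exp.2 ?_))
    push_cast at hσ ⊢
    nlinarith [mul_le_mul_of_nonneg_right hσ (sq_nonneg t)]

/-! ### The explicit mechanism -/

theorem binarySum_eq_of_le {ε δ : ℝ} {m : ℕ} (h : (m : ℝ) ≤ noiseParam ε δ) :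
    binarySum ε δ m = noisyBitSum (1 / 2) ⌈noiseParam ε δ / m⌉₊ m := by
  simp only [binarySum, noisyBitSum, h, if_true]
  congr 1
  funext z
  push_cast
  ring

theorem binarySum_eq_of_lt {ε δ : ℝ} {m : ℕ} (hm : 0 < m) (h : noiseParam ε δ < m) :
    binarySum ε δ m = noisyBitSum (noiseParam ε δ / (2 * m)) 1 m := by
  have hm' : (m : ℝ) ≠ 0 := by positivity
  simp only [binarySum, noisyBitSum, not_le.2 h, if_false]
  congr 1
  · funext x
    simp only [indep, PMF.pure_map, PMF.map_bind]
    rw [← PMF.bind_pure_comp]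
    congr 1
  · funext z
    push_cast
    field_simp

/-- In both regimes the noise has mean at least τ/2. There are fewer than τ + m ≤ 2τ noise bits if m
≤ τ, and exactly m otherwise; a quarter of either number is at most σ². -/
theorem binarySum_isPrivateBinarySum {ε δ : ℝ} (hε : 0 < ε) (hε1 : ε < 1) (hδ : 0 < δ)
    (hδ1 : δ < 1) {m : ℕ} (hm : 0 < m) {σ : ℝ≥0} (hσ : noiseParam ε δ ≤ (σ : ℝ) ^ 2)
    (hmσ : (m : ℝ) ≤ 4 * (σ : ℝ) ^ 2) : (binarySum ε δ m).IsPrivateBinarySum ε δ σ := by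
  have hm' : (0 : ℝ) < m := by positivity
  have hτ : 0 < noiseParam ε δ := by
    have : 0 < Real.log (2 / δ) := Real.log_pos ((one_lt_div hδ).2 (by linarith))
    unfold noiseParam; positivity
  have hτ2 : 48 * Real.log (2 / δ) / ε ^ 2 = noiseParam ε δ / 2 := by unfold noiseParam; ring
  rcases le_or_gt (m : ℝ) (noiseParam ε δ) with h | h
  · rw [binarySum_eq_of_le h]
    have h1 := (div_le_iff₀ hm').1 (Nat.le_ceil (noiseParam ε δ / m))
    have h2 : (⌈noiseParam ε δ / m⌉₊ : ℝ) * m < noiseParam ε δ + m := by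
      have := mul_lt_mul_of_pos_right
        (Nat.ceil_lt_add_one (div_nonneg hτ.le hm'.le : 0 ≤ noiseParam ε δ / m)) hm'
      rwa [add_mul, one_mul, div_mul_cancel₀ _ hm'.ne'] at this
    refine ⟨noisyBitSum_isSDP (by norm_num) le_rfl hδ hε hε1 hδ1 ?_,
      noisyBitSum_hasSubgaussianError (by norm_num) (by norm_num) σ ?_⟩
    · rw [hτ2]; push_cast; linarith
    · push_cast; linarith
  · rw [binarySum_eq_of_lt hm h]
    have hp : noiseParam ε δ / (2 * m) ≤ 1 / 2 := by
      rw [div_le_div_iff₀ (by positivity) (by norm_num)]; linarith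
    refine ⟨noisyBitSum_isSDP (by positivity) hp hδ hε hε1 hδ1 ?_,
      noisyBitSum_hasSubgaussianError (by positivity) (by linarith) σ ?_⟩
    · rw [hτ2]; push_cast; field_simp; rfl
    · push_cast; linarith

theorem binarySum_error_parameter {δ₀ c₀ : ℝ} (hδ₀ : 0 < δ₀) (hδ₀1 : δ₀ < 1) (hc₀ : 0 < c₀) :
    ∃ c₁ c₂ : ℝ, 0 < c₁ ∧ 0 < c₂ ∧
      ∀ ε δ : ℝ, 0 < ε → ε < 1 → 0 < δ → δ ≤ δ₀ →
      ∃ σ : ℝ≥0,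
        c₁ * (Real.log (1 / δ) / ε ^ 2) ≤ (⌈(σ : ℝ) ^ 2⌉₊ : ℝ) ∧
        (⌈(σ : ℝ) ^ 2⌉₊ : ℝ) ≤ c₂ * (Real.log (1 / δ) / ε ^ 2) ∧
        ∀ m : ℕ, 0 < m →
          ((m : ℝ) ≤ c₀ * (Real.log (1 / δ) / ε ^ 2) ∨ m = ⌈(σ : ℝ) ^ 2⌉₊) →
          (binarySum ε δ m).IsPrivateBinarySum ε δ σ := by
  have hl₀ : 0 < Real.log (1 / δ₀) := Real.log_pos ((one_lt_div hδ₀).2 hδ₀1)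
  have hl2 : 0 < Real.log 2 := Real.log_pos (by norm_num)
  -- Since δ ≤ δ₀, log(2/δ) is at most (1 + log 2 / log(1/δ₀)) log(1/δ). The factor 2 absorbs the
  -- ceiling, as τ ≥ 1.
  refine ⟨96, 2 * (96 * (1 + Real.log 2 / Real.log (1 / δ₀)) + c₀), by norm_num, by positivity, ?_⟩
  intro ε δ hε hε1 hδ hδδ₀
  have hδ1 : δ < 1 := hδδ₀.trans_lt hδ₀1
  have hlog : Real.log (1 / δ₀) ≤ Real.log (1 / δ) :=
    Real.log_le_log (by positivity) (one_div_le_one_div_of_le hδ hδδ₀)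
  have hsplit : Real.log (2 / δ) = Real.log 2 + Real.log (1 / δ) := by
    rw [← Real.log_mul (by norm_num) (by positivity)]; ring_nf
  set L := Real.log (1 / δ) / ε ^ 2 with hL
  have hL0 : 0 < L := div_pos (hl₀.trans_le hlog) (by positivity)
  have hτlow : 96 * L ≤ noiseParam ε δ := by
    rw [hL, noiseParam, hsplit, ← mul_div_assoc]
    gcongr; linarith
  have hτup : noiseParam ε δ ≤ 96 * (1 + Real.log 2 / Real.log (1 / δ₀)) * L := by
    rw [hL, noiseParam, hsplit, ← mul_div_assoc]
    refine div_le_div_of_nonneg_right ?_ (by positivity)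
    have : Real.log 2 ≤ Real.log 2 / Real.log (1 / δ₀) * Real.log (1 / δ) := by
      rw [div_mul_eq_mul_div, le_div_iff₀ hl₀]; gcongr
    linarith
  have hτ1 : 1 ≤ noiseParam ε δ := by
    rw [noiseParam, le_div_iff₀ (by positivity), hsplit]
    have := Real.log_two_gt_d9
    nlinarith
  have hc₀L : 0 < c₀ * L := by positivity
  -- The choice σ² = τ + c₀L gives σ² ≥ τ and m ≤ 4σ² for every m ≤ c₀L, and also for m = ⌈σ²⌉
  -- because σ² ≥ 1.
  have hsq : ((NNReal.sqrt (noiseParam ε δ + c₀ * L).toNNReal : ℝ≥0) : ℝ) ^ 2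
      = noiseParam ε δ + c₀ * L := by
    rw [← NNReal.coe_pow, NNReal.sq_sqrt, Real.coe_toNNReal _ (by linarith)]
  refine ⟨NNReal.sqrt (noiseParam ε δ + c₀ * L).toNNReal, ?_, ?_, ?_⟩
  · rw [hsq]
    exact (by linarith : 96 * L ≤ noiseParam ε δ + c₀ * L).trans (Nat.le_ceil _)
  · rw [hsq]
    have := Nat.ceil_lt_add_one (by linarith : 0 ≤ noiseParam ε δ + c₀ * L)
    linarith
  · intro m hm hcase
    refine binarySum_isPrivateBinarySum hε hε1 hδ hδ1 hm (by rw [hsq]; linarith) ?_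
    rw [hsq]
    rcases hcase with h | h
    · linarith
    · rw [hsq] at h
      have := Nat.ceil_lt_add_one (by linarith : 0 ≤ noiseParam ε δ + c₀ * L)
      rw [h]
      linarith

theorem mainTheorem4 :
    -- arm elimination with batch size `Θ(log (1 / δ) / ε ^ 2)` is private and has small regret
    (∀ c₁ c₂ c₃ : ℝ, 0 < c₁ → 0 < c₂ → 0 < c₃ → ∃ C : ℝ, 0 < C ∧
      ∀ ε δ : ℝ, 0 < ε → ε < 1 → 0 < δ → δ < 1 →
      ∀ m : ℕ, c₁ * (Real.log (1 / δ) / ε ^ 2) ≤ m → m ≤ c₂ * (Real.log (1 / δ) / ε ^ 2) →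
      ∀ σ : ℝ≥0, (σ : ℝ) ^ 2 ≤ c₃ * (Real.log (1 / δ) / ε ^ 2) →
      ∀ (Y : Type*) (M : ShuffleMechanism m Y), M.IsPrivateBinarySum ε δ σ →
      ∀ (k : ℕ) [NeZero k] (T : ℕ),
        (sdpAE k M σ T).IsSDP ε δ ∧
        ∀ ν : Fin k → PMF Bool,
          regret (sdpAE k M σ T) ν T
            ≤ C * ∑ a with 0 < gap ν a,
                (Real.log T / gap ν a + gap ν a * Real.log (1 / δ) / ε ^ 2) ∧
          regret (sdpAE k M σ T) ν T
            ≤ C * ((∑ a with 0 < gap ν a, Real.log T / gap ν a)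
                + k * Real.log (1 / δ) / ε ^ 2) ∧
          regret (sdpAE k M σ T) ν T
            ≤ C * (√(k * T * Real.log T) + k * Real.log (1 / δ) / ε ^ 2)) ∧
    -- the explicit mechanism may be used in it, in particular with batch size `⌈σ ^ 2⌉`
    (∀ δ₀ c₀ : ℝ, 0 < δ₀ → δ₀ < 1 → 0 < c₀ → ∃ c₁ c₂ : ℝ, 0 < c₁ ∧ 0 < c₂ ∧
      ∀ ε δ : ℝ, 0 < ε → ε < 1 → 0 < δ → δ ≤ δ₀ →
      ∃ σ : ℝ≥0,
        c₁ * (Real.log (1 / δ) / ε ^ 2) ≤ (⌈(σ : ℝ) ^ 2⌉₊ : ℝ) ∧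
        (⌈(σ : ℝ) ^ 2⌉₊ : ℝ) ≤ c₂ * (Real.log (1 / δ) / ε ^ 2) ∧
        ∀ m : ℕ, 0 < m →
          ((m : ℝ) ≤ c₀ * (Real.log (1 / δ) / ε ^ 2) ∨ m = ⌈(σ : ℝ) ^ 2⌉₊) →
          (binarySum ε δ m).IsPrivateBinarySum ε δ σ) :=
  ⟨fun _ _ _ h₁ h₂ h₃ => sdpAE_bounds h₁ h₂ h₃,
    fun _ _ h₁ h₂ h₃ => binarySum_error_parameter h₁ h₂ h₃⟩
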